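/- Let $\Lambda$ be a small category, identified with its set of morphisms, with source and range maps $s,r$; the product $\alpha\beta$ is defined when $s(\alpha)=r(\beta)$. Suppose that $\Lambda$ is countable, left and right cancellative, and finitely aligned, i.e. for all $\alpha,\beta\in\Lambda$ there is a finite set $\Gamma\subseteq\Lambda$ with $\alpha\Lambda\cap\beta\Lambda=\bigcup_{\gamma\in\Gamma}\gamma\Lambda$. Write $\alpha\le\beta$ if $\beta\in\alpha\Lambda$. Let $\mathcal S_\Lambda$ be the inverse semigroup of partial bijections of $\Lambda$ generated by the maps $\tau^\alpha:s(\alpha)\Lambda\to\alpha\Lambda$, $\beta\mapsto\alpha\beta$, and their inverses $\sigma^\alpha$ ($\alpha\in\Lambda$). Let $\mathcal E$ be its semilattice of idempotents, ordered by $e\le f\iff e=ef$. A filter is a nonempty, upward closed subset of $\mathcal E$ that is closed under products and does not contain the empty map; the space of filters has as basis of open sets the sets of all filters containing $X$ and disjoint from $Y$, for finite $X,Y\subseteq\mathcal E$. The space $\widehat{\mathcal E}_{\rm tight}$ of tight filters is the closure of the set of ultrafilters (maximal filters), and $s\in\mathcal S_\Lambda$ acts on the tight filters $\eta$ containing $s^*s$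 by $s\cdot\eta=\{f\in\mathcal E: ses^*\le f\text{ for some }e\in\eta\}$. Let $\Lambda^*$ be the set of nonempty subsets $F\subseteq\Lambda$ that are hereditary ($\alpha\le\beta\in F$ implies $\alpha\in F$) and directed (any $\alpha,\beta\in F$ have an upper bound in $F$ for $\le$), with the topology having as basis the sets $\{F: X\subseteq F,\ Y\cap F=\emptyset\}$ for finite $X,Y\subseteq\Lambda$. Let $\Lambda_{\rm tight}\subseteq\Lambda^*$ be the subspace of those $F$ such that for every $\alpha\in F$, every finite $B\subseteq\Lambda$ with $B\cap F=\emptyset$, and every finite $Z\subseteq A:=\alpha\Lambda\setminus\bigcup_{\beta\in B}\beta\Lambda$ such that each $\gamma\in A$ has a common extension with some $\zeta\in Z$ (i.e. $\gamma\Lambda\cap\zeta\Lambda\neq\emptyset$), one has $F\cap Z\ne\emptyset$. An element $s\in\mathcal S_\Lambda$ acts on the $F\in\Lambda_{\rm tight}$ meeting the domain of $s$ by $s\cdot F=\{\delta:\delta\le s(\gamma)\text{ for some }\gamma\in F\cap\operatorname{dom}(s)\}$. For an action of an inverse semigroup $\mathcal S$ on a space $X$, with the domain of $s$ denoted $D_{s^*s}$,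 let $\mathcal S\rtimes X$ be the topological groupoid of germs $[s,x]$ ($x\in D_{s^*s}$), where $[s,x]=[t,y]$ iff $x=y$ and $se=te$ for some idempotent $e$ with $x\in D_e$; its operations are $d[s,x]=x$, $r[s,x]=s\cdot x$, $[s,t\cdot y][t,y]=[st,y]$, $[s,x]^{-1}=[s^*,s\cdot x]$, and its topology has as basis the sets $\{[s,x]:x\in U\}$ with $U\subseteq D_{s^*s}$ open. Put $\mathcal G_{\rm tight}(\mathcal S_\Lambda):=\mathcal S_\Lambda\rtimes\widehat{\mathcal E}_{\rm tight}$. Then $\mathcal G_{\rm tight}(\mathcal S_\Lambda)$ and $\mathcal S_\Lambda\rtimes\Lambda_{\rm tight}$ are isomorphic as topological groupoids, and both are Hausdorff. -/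

import Mathlib

open CategoryTheory Set
universe u v

noncomputable section

namespace TightGroupoid

/-! ### Groupoids (given by their arrows and units) and their isomorphisms -/

/-- A topological groupoid with space of arrows `G` and space of units `X`: domain `d`, range `r`,
identities `one`, product `g h` defined when `d g = r h`, and inverses. -/
structure TopGroupoid (G : Type*) (X : Type*) [TopologicalSpace G] [TopologicalSpace X] where
  d : G → X
  r : G → X
  one : X → G
  mul : (g h : G) → d g = r h → G
  inv : G → G
  d_one : ∀ x, d (one x) = x
  r_one : ∀ x, r (one x) = x
  d_mul : ∀ g h e, d (mul g h e) = d h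
  r_mul : ∀ g h e, r (mul g h e) = r g
  d_inv : ∀ g, d (inv g) = r g
  r_inv : ∀ g, r (inv g) = d g
  one_mul : ∀ g, mul (one (r g)) g (d_one _) = g
  mul_one : ∀ g, mul g (one (d g)) (r_one _).symm = g
  mul_assoc : ∀ (g h k : G) (e : d g = r h) (e' : d h = r k),
    mul (mul g h e) k ((d_mul g h e).trans e') = mul g (mul h k e') (e.trans (r_mul h k e').symm)
  inv_mul : ∀ g, mul (inv g) g (d_inv g) = one (d g)
  mul_inv : ∀ g, mul g (inv g) (r_inv g).symm = one (r g)
  continuous_d : Continuous d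
  continuous_r : Continuous r
  continuous_one : Continuous one
  continuous_inv : Continuous inv
  continuous_mul : Continuous fun p : {p : G × G // d p.1 = r p.2} => mul p.1.1 p.1.2 p.2

/-- An isomorphism of topological groupoids: homeomorphisms between the arrows and between the
units which respect domain, range and product. -/
structure TopGroupoidIso {G X H Y : Type*} [TopologicalSpace G] [TopologicalSpace X]
    [TopologicalSpace H] [TopologicalSpace Y] (A : TopGroupoid G X) (B : TopGroupoid H Y) where
  arrows : G ≃ₜ H
  units : X ≃ₜ Y
  map_d : ∀ g, B.d (arrows g) = units (A.d g)
  map_r : ∀ g, B.r (arrows g) = units (A.r g)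
  map_mul : ∀ (g h : G) (e : A.d g = A.r h),
    arrows (A.mul g h e) =
      B.mul (arrows g) (arrows h) ((map_d g).trans ((congrArg units e).trans (map_r h).symm))

/-! ### The symmetric inverse monoid and its inverse subsemigroups -/

section Inverse

variable {X : Type*}

/-- The product of partial bijections of `X` is composition, `(g * f) x = g (f x)`. -/
instance : Semigroup (X ≃. X) where
  mul g f := f.trans g
  mul_assoc h g f := (PEquiv.trans_assoc f g h).symm

/-- The involution of the symmetric inverse monoid: the inverse partial bijection. -/
instance : Star (X ≃. X) := ⟨PEquiv.symm⟩

theorem mem_mul {g f : X ≃. X} {a c : X} : c ∈ (g * f) a ↔ ∃ b, b ∈ f a ∧ c ∈ g b :=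
  PEquiv.mem_trans f g a c

theorem mem_star {f : X ≃. X} {a b : X} : a ∈ (star f) b ↔ b ∈ f a := PEquiv.mem_iff_mem f

theorem mem_ext {f g : X ≃. X} (h : ∀ a b, b ∈ f a ↔ b ∈ g a) : f = g :=
  PEquiv.ext fun a => Option.ext fun b => h a b

theorem mem_idem {e : X ≃. X} (he : IsIdempotentElem e) {a b : X} (h : b ∈ e a) : b = a := by
  have h' := h
  rw [← he.eq, mem_mul] at h'
  obtain ⟨c, hc, hb⟩ := h'
  have : c = b := Option.mem_unique hc h
  subst this
  exact e.inj hb h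

/-- An inverse semigroup of partial bijections of `X`: a set of partial bijections closed under
composition and inverses. Its zero, if it has one, is the empty map `⊥`. -/
structure InverseSubsemigroup (X : Type*) extends Subsemigroup (X ≃. X) where
  star_mem' : ∀ f ∈ carrier, star f ∈ carrier

instance : SetLike (InverseSubsemigroup X) (X ≃. X) where
  coe S := S.carrier
  coe_injective S T h := by
    cases S; cases T
    congr
    exact SetLike.coe_injective h

instance : MulMemClass (InverseSubsemigroup X) (X ≃. X) where
  mul_mem {S} _ _ ha hb := S.mul_mem' ha hb

instance (S : InverseSubsemigroup X) : Star S := ⟨fun s => ⟨star s.1, S.star_mem' s.1 s.2⟩⟩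

variable {S : InverseSubsemigroup X}

theorem mul_star_mul (s : S) : s * star s * s = s := by
  apply Subtype.ext
  apply mem_ext
  intro a b
  change b ∈ (s.1 * star s.1 * s.1) a ↔ b ∈ s.1 a
  simp only [mem_mul, mem_star]
  constructor
  · rintro ⟨c, hc, d, hd, hb⟩
    rwa [s.1.inj hc hd]
  · intro h
    exact ⟨b, h, a, h, h⟩

theorem star_star' (s : S) : star (star s) = s := rfl

theorem star_mul' (s t : S) : star (s * t) = star t * star s := rfl

theorem idem_val {e : S} (he : IsIdempotentElem e) : IsIdempotentElem e.1 :=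
  congrArg Subtype.val he

theorem idem_comm {e f : S} (he : IsIdempotentElem e) (hf : IsIdempotentElem f) :
    e * f = f * e := by
  apply Subtype.ext
  apply mem_ext
  intro a b
  change b ∈ (e.1 * f.1) a ↔ b ∈ (f.1 * e.1) a
  simp only [mem_mul]
  constructor
  · rintro ⟨c, hc, hb⟩
    obtain rfl := mem_idem (idem_val hf) hc
    obtain rfl := mem_idem (idem_val he) hb
    exact ⟨_, hb, hc⟩
  · rintro ⟨c, hc, hb⟩
    obtain rfl := mem_idem (idem_val he) hc
    obtain rfl := mem_idem (idem_val hf) hb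
    exact ⟨_, hb, hc⟩

theorem idem_star {e : S} (he : IsIdempotentElem e) : star e = e := by
  apply Subtype.ext
  apply mem_ext
  intro a b
  change b ∈ star e.1 a ↔ b ∈ e.1 a
  simp only [mem_star]
  constructor <;> intro h <;> obtain rfl := mem_idem (idem_val he) h <;> exact h

theorem idem_mul {e f : S} (he : IsIdempotentElem e) (hf : IsIdempotentElem f) :
    IsIdempotentElem (e * f) := by
  change e * f * (e * f) = e * f
  rw [mul_assoc, ← mul_assoc f e f, idem_comm hf he, mul_assoc e f f, hf.eq, ← mul_assoc, he.eq]

theorem idem_star_mul (s : S) : IsIdempotentElem (star s * s) := by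
  change star s * s * (star s * s) = star s * s
  rw [mul_assoc, ← mul_assoc s, mul_star_mul]

theorem idem_mul_star (s : S) : IsIdempotentElem (s * star s) := idem_star_mul (star s)

theorem idem_conj (s : S) {e : S} (he : IsIdempotentElem e) :
    IsIdempotentElem (star s * e * s) := by
  have h : star s * e * s = star (e * s) * (e * s) := by
    rw [star_mul', idem_star he, mul_assoc, mul_assoc, ← mul_assoc e e, he.eq]
  rw [h]
  exact idem_star_mul _

/-- `f (s s⋆) = (s s⋆) f`, in the form used for rewriting. -/
theorem mul_mul_star_comm (s : S) {f : S} (hf : IsIdempotentElem f) :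
    star s * f * (s * star s) = star s * f := by
  rw [mul_assoc, idem_comm hf (idem_mul_star s), ← mul_assoc, ← mul_assoc, ← star_star' s,
    star_star' s]
  rw [show star s * s * star s = star s from mul_star_mul (star s)]

end Inverse

/-! ### Actions of inverse semigroups and their groupoids of germs -/

section Germs

variable {X : Type*} {S : InverseSubsemigroup X} {Y : Type*} [TopologicalSpace Y]

/-- A (partial) action of an inverse semigroup on a space `Y`: each `s` acts as a
homeomorphism from an open set `dom s` (usually written `D_{s⋆ s}`) onto `dom s⋆`, the product
acts by composition of partial maps, and the domains cover `Y`. -/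
structure InvAction (S : InverseSubsemigroup X) (Y : Type*) [TopologicalSpace Y] where
  dom : S → Set Y
  act : (s : S) → dom s → Y
  mem_dom_mul : ∀ (s t : S) (y : Y), y ∈ dom (s * t) ↔ ∃ h : y ∈ dom t, act t ⟨y, h⟩ ∈ dom s
  act_mul : ∀ (s t : S) (y : Y) (h : y ∈ dom (s * t)) (h₁ : y ∈ dom t)
    (h₂ : act t ⟨y, h₁⟩ ∈ dom s), act (s * t) ⟨y, h⟩ = act s ⟨act t ⟨y, h₁⟩, h₂⟩
  act_mem : ∀ (s : S) (y : dom s), act s y ∈ dom (star s)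
  act_star : ∀ (s : S) (y : dom s), act (star s) ⟨act s y, act_mem s y⟩ = y
  cover : ∀ y, ∃ s, y ∈ dom s
  isOpen_dom : ∀ s, IsOpen (dom s)
  continuous_act : ∀ s, Continuous (act s)

namespace InvAction

variable (A : InvAction S Y)

theorem act_congr {s t : S} (h : s = t) {x y : Y} (hx : x ∈ A.dom s) (hxy : x = y) :
    A.act s ⟨x, hx⟩ = A.act t ⟨y, by subst h; subst hxy; exact hx⟩ := by
  subst h; subst hxy; rfl

theorem mem_dom_star_mul (s : S) (y : Y) : y ∈ A.dom (star s * s) ↔ y ∈ A.dom s := by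
  rw [A.mem_dom_mul]
  exact ⟨fun h => h.1, fun h => ⟨h, A.act_mem s ⟨y, h⟩⟩⟩

theorem act_idem {e : S} (he : IsIdempotentElem e) (y : Y) (h : y ∈ A.dom e) :
    A.act e ⟨y, h⟩ = y := by
  have h1 : y ∈ A.dom (star e * e) := (A.mem_dom_star_mul e y).2 h
  have h2 := A.act_mul (star e) e y h1 h (A.act_mem e ⟨y, h⟩)
  rw [A.act_star] at h2
  refine Eq.trans ?_ h2
  exact A.act_congr (by rw [idem_star he, he.eq]) _ rfl

theorem mem_dom_mul_idem {s e : S} (he : IsIdempotentElem e) (y : Y) :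
    y ∈ A.dom (s * e) ↔ y ∈ A.dom s ∧ y ∈ A.dom e := by
  rw [A.mem_dom_mul]
  constructor
  · rintro ⟨h, h'⟩
    rw [A.act_idem he] at h'
    exact ⟨h', h⟩
  · rintro ⟨h, h'⟩
    refine ⟨h', ?_⟩
    rwa [A.act_idem he]

theorem act_mul_idem {s e : S} (he : IsIdempotentElem e) (y : Y) (h : y ∈ A.dom (s * e))
    (h' : y ∈ A.dom s) : A.act (s * e) ⟨y, h⟩ = A.act s ⟨y, h'⟩ := by
  have he' := ((A.mem_dom_mul_idem he y).1 h).2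
  rw [A.act_mul s e y h he' (by rwa [A.act_idem he])]
  exact A.act_congr rfl _ (A.act_idem he y he')

/-- The pairs `(s, y)` with `y` in the domain of `s`. -/
abbrev Pairs := {p : S × Y // p.2 ∈ A.dom p.1}

/-- `(s, x) ∼ (t, y)` iff `x = y` and `s e = t e` for some idempotent `e` with `x ∈ D_e`. -/
def germSetoid : Setoid A.Pairs where
  r p q := p.1.2 = q.1.2 ∧
    ∃ e : S, IsIdempotentElem e ∧ p.1.2 ∈ A.dom e ∧ p.1.1 * e = q.1.1 * e
  iseqv :=
    { refl := fun p => ⟨rfl, star p.1.1 * p.1.1, idem_star_mul _,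
        (A.mem_dom_star_mul _ _).2 p.2, rfl⟩
      symm := by
        rintro p q ⟨h, e, he, hm, heq⟩
        exact ⟨h.symm, e, he, h ▸ hm, heq.symm⟩
      trans := by
        rintro p q r ⟨h, e, he, hm, heq⟩ ⟨h', f, hf, hm', heq'⟩
        refine ⟨h.trans h', e * f, idem_mul he hf,
          (A.mem_dom_mul_idem hf _).2 ⟨hm, by rw [h]; exact hm'⟩, ?_⟩
        rw [← mul_assoc, heq, mul_assoc, idem_comm he hf, ← mul_assoc, heq', mul_assoc,
          idem_comm hf he] }

/-- The set `S ⋉ Y` of germs of the action. -/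
def Germ : Type _ := Quotient A.germSetoid

variable {A}

/-- The germ `[s, y]`. -/
def germ (s : S) (y : Y) (h : y ∈ A.dom s) : A.Germ := Quotient.mk A.germSetoid ⟨(s, y), h⟩

theorem germ_eq {s t : S} {x y : Y} {h : x ∈ A.dom s} {h' : y ∈ A.dom t} :
    germ s x h = germ t y h' ↔
      x = y ∧ ∃ e : S, IsIdempotentElem e ∧ x ∈ A.dom e ∧ s * e = t * e := by
  exact Quotient.eq (r := A.germSetoid)

theorem exists_germ (g : A.Germ) : ∃ s y, ∃ h : y ∈ A.dom s, g = germ s y h := by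
  induction g using Quotient.inductionOn with
  | h p => exact ⟨p.1.1, p.1.2, p.2, rfl⟩

variable (A)

/-- `Θ(s, U) = {[s, x] : x ∈ U}`, for `U ⊆ D_{s⋆ s}`. -/
def Theta (s : S) (U : Set Y) : Set A.Germ := {g | ∃ x ∈ U, ∃ h : x ∈ A.dom s, g = germ s x h}

/-- The topology on `S ⋉ Y` with basis the sets `Θ(s, U)`, `U ⊆ D_{s⋆ s}` open. -/
instance : TopologicalSpace A.Germ :=
  TopologicalSpace.generateFrom {W | ∃ s U, IsOpen U ∧ U ⊆ A.dom s ∧ W = A.Theta s U}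

theorem isOpen_Theta (s : S) {U : Set Y} (hU : IsOpen U) (h : U ⊆ A.dom s) :
    IsOpen (A.Theta s U) := TopologicalSpace.isOpen_generateFrom_of_mem ⟨s, U, hU, h, rfl⟩

/-- `d [s, x] = x`. -/
def d : A.Germ → Y := Quotient.lift (fun p => p.1.2) fun _ _ h => h.1

/-- `r [s, x] = s · x`. -/
def r : A.Germ → Y := Quotient.lift (fun p => A.act p.1.1 ⟨p.1.2, p.2⟩) <| by
  rintro ⟨⟨s, x⟩, hs⟩ ⟨⟨t, y⟩, ht⟩ ⟨h, e, he, hm, heq⟩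
  dsimp only at *
  subst h
  have h1 : x ∈ A.dom (s * e) := (A.mem_dom_mul_idem he x).2 ⟨hs, hm⟩
  rw [← A.act_mul_idem he x h1 hs,
    ← A.act_mul_idem he x ((A.mem_dom_mul_idem he x).2 ⟨ht, hm⟩) ht]
  exact A.act_congr heq h1 rfl

/-- `[s, x]⁻¹ = [s⋆, s · x]`. -/
def inv : A.Germ → A.Germ :=
  Quotient.lift (fun p => germ (star p.1.1) (A.act p.1.1 ⟨p.1.2, p.2⟩) (A.act_mem _ _)) <| by
  rintro ⟨⟨s, x⟩, hs⟩ ⟨⟨t, y⟩, ht⟩ hst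
  have hr : A.act s ⟨x, hs⟩ = A.act t ⟨y, ht⟩ := congrArg A.r (Quotient.sound hst)
  obtain ⟨h, e, he, hm, heq⟩ := hst
  dsimp only at *
  subst h
  rw [germ_eq]
  refine ⟨hr, s * e * star s, idem_conj (star s) he, ?_, ?_⟩
  · have h3 : A.act s ⟨x, hs⟩ ∈ A.dom (star s) := A.act_mem s ⟨x, hs⟩
    have h4 : A.act (star s) ⟨_, h3⟩ = x := A.act_star s ⟨x, hs⟩
    rw [A.mem_dom_mul]
    refine ⟨h3, ?_⟩
    rw [h4]
    exact (A.mem_dom_mul_idem he x).2 ⟨hs, hm⟩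
  · have key : ∀ a : S, star a * (a * e * star a) = star (a * e) := by
      intro a
      rw [star_mul', idem_star he, ← mul_assoc, ← mul_assoc, mul_assoc _ e,]
      rw [← mul_assoc]
      rw [idem_comm (idem_star_mul a) he, mul_assoc, mul_assoc, ← mul_assoc (star a)]
      rw [show star a * a * star a = star a from mul_star_mul (star a)]
    have h2 : s * e * star s = t * e * star t := by
      have : ∀ a : S, a * e * star a = (a * e) * star (a * e) := by
        intro a
        rw [star_mul', idem_star he, ← mul_assoc, mul_assoc a e e, he.eq]
      rw [this s, this t, heq]
    rw [key s, h2, key t, heq]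

theorem mul_mem (g h : A.Germ) (e : A.d g = A.r h) :
    h.out.1.2 ∈ A.dom (g.out.1.1 * h.out.1.1) := by
  rw [A.mem_dom_mul]
  refine ⟨h.out.2, ?_⟩
  have h1 : A.d g = g.out.1.2 := congrArg A.d (Quotient.out_eq g).symm
  have h2 : A.r h = A.act h.out.1.1 ⟨h.out.1.2, h.out.2⟩ := congrArg A.r (Quotient.out_eq h).symm
  rw [← h2, ← e, h1]
  exact g.out.2

theorem germ_mul_wd {s t : S} {x y : Y} (hs : x ∈ A.dom s) (ht : y ∈ A.dom t) (p q : A.Pairs)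
    (h1 : A.germSetoid.r p ⟨(s, x), hs⟩) (h2 : A.germSetoid.r q ⟨(t, y), ht⟩)
    (e : x = A.act t ⟨y, ht⟩) (hm : q.1.2 ∈ A.dom (p.1.1 * q.1.1)) (hm' : y ∈ A.dom (s * t)) :
    germ (p.1.1 * q.1.1) q.1.2 hm = germ (s * t) y hm' := by
  obtain ⟨⟨s', x'⟩, hs'⟩ := p
  obtain ⟨⟨t', y'⟩, ht'⟩ := q
  obtain ⟨hx, f, hf, hmf, hff⟩ := h1
  obtain ⟨hy, k, hk, hmk, hkk⟩ := h2
  dsimp only at *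
  subst hx hy
  rw [germ_eq]
  refine ⟨rfl, star t * f * t * k, idem_mul (idem_conj t hf) hk, ?_, ?_⟩
  · rw [A.mem_dom_mul_idem hk]
    refine ⟨?_, hmk⟩
    rw [mul_assoc, A.mem_dom_mul, ]
    have h3 : y' ∈ A.dom (f * t) := by
      rw [A.mem_dom_mul]
      exact ⟨ht, e ▸ hmf⟩
    refine ⟨h3, ?_⟩
    rw [A.act_mul f t y' h3 ht (e ▸ hmf)]
    have h4 : A.act t ⟨y', ht⟩ ∈ A.dom f := e ▸ hmf
    rw [A.act_idem hf _ h4]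
    exact A.act_mem t ⟨y', ht⟩
  · have c1 : ∀ a : S, a * (star t * f * t * k) = a * k * (star t * f * t) := by
      intro a
      rw [mul_assoc a k, idem_comm hk (idem_conj t hf)]
    have c2 : t * (star t * f * t * k) = f * (t * k) := by
      rw [← mul_assoc, ← mul_assoc, ← mul_assoc, idem_comm (idem_mul_star t) hf,
        mul_assoc f, mul_star_mul, mul_assoc]
    have c3 : t' * (star t * f * t * k) = f * (t * k) := by
      rw [c1 t', hkk, ← c1 t, c2]
    rw [mul_assoc, c3, mul_assoc s t, c2, ← mul_assoc, hff, mul_assoc]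

/-- `[s, x] [t, y] = [s t, y]` when `x = t · y` (computed on representatives; see `mul_germ`). -/
def mul (g h : A.Germ) (e : A.d g = A.r h) : A.Germ :=
  germ (g.out.1.1 * h.out.1.1) h.out.1.2 (A.mul_mem g h e)

theorem mul_germ (s t : S) (x y : Y) (hs : x ∈ A.dom s) (ht : y ∈ A.dom t)
    (e : x = A.act t ⟨y, ht⟩) :
    A.mul (germ s x hs) (germ t y ht) e =
      germ (s * t) y ((A.mem_dom_mul s t y).2 ⟨ht, e ▸ hs⟩) := by
  exact A.germ_mul_wd _ _ _ _ (Quotient.exact (Quotient.out_eq (germ s x hs)))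
    (Quotient.exact (Quotient.out_eq (germ t y ht))) e _ _

/-- The unit `[e, y]` at `y`, for any idempotent `e` with `y ∈ D_e` (see `one_eq`). -/
def one (y : Y) : A.Germ :=
  germ (star (A.cover y).choose * (A.cover y).choose) y
    ((A.mem_dom_star_mul _ _).2 (A.cover y).choose_spec)

theorem one_eq {e : S} (he : IsIdempotentElem e) (y : Y) (h : y ∈ A.dom e) :
    A.one y = germ e y h := by
  unfold one
  rw [germ_eq]
  have h1 := (A.mem_dom_star_mul _ _).2 (A.cover y).choose_spec
  have h2 := idem_star_mul (A.cover y).choose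
  refine ⟨rfl, _, idem_mul h2 he, (A.mem_dom_mul_idem he y).2 ⟨h1, h⟩, ?_⟩
  rw [← mul_assoc, h2.eq, idem_comm h2 he, ← mul_assoc e e, he.eq]

theorem germ_congr {s t : S} {x y : Y} (h : s = t) (hxy : x = y) {hs : x ∈ A.dom s}
    {ht : y ∈ A.dom t} : germ s x hs = germ t y ht := by
  subst h; subst hxy; rfl

theorem inv_inv (g : A.Germ) : A.inv (A.inv g) = g := by
  obtain ⟨s, y, h, rfl⟩ := exists_germ g
  exact A.germ_congr rfl (A.act_star s ⟨y, h⟩)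

theorem continuous_d : Continuous A.d := by
  rw [continuous_def]
  intro U hU
  have : A.d ⁻¹' U = ⋃ s : S, A.Theta s (U ∩ A.dom s) := by
    ext g
    obtain ⟨s, y, h, rfl⟩ := exists_germ g
    rw [mem_iUnion]
    constructor
    · intro hy
      exact ⟨s, y, ⟨hy, h⟩, h, rfl⟩
    · rintro ⟨t, x, hx, hx', e⟩
      rw [e]
      exact hx.1
  rw [this]
  exact isOpen_iUnion fun s => A.isOpen_Theta s (hU.inter (A.isOpen_dom s)) inter_subset_right

theorem continuous_inv : Continuous A.inv := by
  apply continuous_generateFrom_iff.2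
  rintro _ ⟨s, U, hU, hUs, rfl⟩
  have : A.inv ⁻¹' A.Theta s U =
      A.Theta (star s) (Subtype.val '' (A.act (star s) ⁻¹' U)) := by
    ext g
    constructor
    · rintro ⟨x, hx, hx', e⟩
      refine ⟨A.act s ⟨x, hx'⟩, ⟨⟨_, A.act_mem s ⟨x, hx'⟩⟩, ?_, rfl⟩, A.act_mem s ⟨x, hx'⟩, ?_⟩
      · rw [mem_preimage, A.act_star]; exact hx
      · rw [← A.inv_inv g, e]; rfl
    · rintro ⟨x, ⟨z, hz, rfl⟩, hx', rfl⟩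
      exact ⟨_, hz, A.act_mem (star s) z, rfl⟩
  rw [this]
  refine A.isOpen_Theta _ ?_ ?_
  · exact (A.isOpen_dom _).isOpenMap_subtype_val _ (hU.preimage (A.continuous_act _))
  · rintro _ ⟨z, _, rfl⟩
    exact z.2

theorem r_eq : A.r = A.d ∘ A.inv := by
  funext g
  obtain ⟨s, y, h, rfl⟩ := exists_germ g
  rfl

theorem continuous_one : Continuous A.one := by
  apply continuous_generateFrom_iff.2
  rintro _ ⟨s, U, hU, hUs, rfl⟩
  rw [isOpen_iff_forall_mem_open]
  rintro y ⟨x, hx, hx', e⟩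
  obtain rfl : y = x := congrArg A.d e
  obtain ⟨t, ht⟩ := A.cover y
  have ht' := (A.mem_dom_star_mul _ _).2 ht
  rw [A.one_eq (idem_star_mul t) y ht', germ_eq] at e
  obtain ⟨-, f, hf, hm, hff⟩ := e
  refine ⟨U ∩ (A.dom (star t * t) ∩ A.dom f), ?_,
    hU.inter ((A.isOpen_dom _).inter (A.isOpen_dom _)), hx, ht', hm⟩
  rintro z ⟨hz, hz1, hz2⟩
  refine ⟨z, hz, hUs hz, ?_⟩
  rw [A.one_eq (idem_star_mul t) z hz1, germ_eq]
  exact ⟨rfl, f, hf, hz2, hff⟩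

theorem continuous_mul :
    Continuous fun p : {p : A.Germ × A.Germ // A.d p.1 = A.r p.2} => A.mul p.1.1 p.1.2 p.2 := by
  apply continuous_generateFrom_iff.2
  rintro _ ⟨s, U, hU, hUs, rfl⟩
  rw [isOpen_iff_forall_mem_open]
  rintro ⟨⟨g, h⟩, hgh⟩ ⟨z, hz, hz', e⟩
  obtain ⟨a, x, ha, rfl⟩ := exists_germ g
  obtain ⟨b, y, hb, rfl⟩ := exists_germ h
  dsimp only at e hgh
  rw [A.mul_germ a b x y ha hb hgh, germ_eq] at e
  obtain ⟨rfl, f, hf, hm, hff⟩ := e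
  refine ⟨Subtype.val ⁻¹' (A.Theta a (A.dom a) ×ˢ A.Theta b (U ∩ A.dom f ∩ A.dom b)), ?_,
    ?_, ?_⟩
  · rintro ⟨⟨g, h⟩, hgh'⟩ ⟨⟨x', hx', hx2, rfl⟩, ⟨y', ⟨⟨hy1, hy2⟩, hy3⟩, hy4, rfl⟩⟩
    refine ⟨y', hy1, hUs hy1, ?_⟩
    dsimp only at hgh' ⊢
    rw [A.mul_germ a b x' y' hx2 hy4 hgh', germ_eq]
    exact ⟨rfl, f, hf, hy2, hff⟩
  · refine IsOpen.preimage continuous_subtype_val (IsOpen.prod ?_ ?_)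
    · exact A.isOpen_Theta a (A.isOpen_dom a) Subset.rfl
    · exact A.isOpen_Theta b ((hU.inter (A.isOpen_dom f)).inter (A.isOpen_dom b))
        inter_subset_right
  · exact ⟨⟨x, ha, ha, rfl⟩, ⟨y, ⟨⟨hz, hm⟩, hb⟩, hb, rfl⟩⟩

/-- The groupoid of germs `S ⋉ Y` of an action of an inverse semigroup `S` on `Y`. -/
def groupoid : TopGroupoid A.Germ Y where
  d := A.d
  r := A.r
  one := A.one
  mul := A.mul
  inv := A.inv
  d_one _ := rfl
  r_one y := A.act_idem (idem_star_mul _) y _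
  d_mul g h e := (congrArg A.d (Quotient.out_eq h) : A.d (Quotient.mk A.germSetoid _) = A.d h)
  r_mul g h e := by
    obtain ⟨s, x, hs, rfl⟩ := exists_germ g
    obtain ⟨t, y, ht, rfl⟩ := exists_germ h
    rw [A.mul_germ s t x y hs ht e]
    change A.act (s * t) _ = A.act s _
    have e' : x = A.act t ⟨y, ht⟩ := e
    rw [A.act_mul s t y _ ht (e' ▸ hs)]
    exact A.act_congr rfl _ e'.symm
  d_inv g := by
    obtain ⟨s, x, hs, rfl⟩ := exists_germ g
    rfl
  r_inv g := by
    obtain ⟨s, x, hs, rfl⟩ := exists_germ g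
    exact A.act_star s ⟨x, hs⟩
  one_mul g := by
    obtain ⟨s, x, hs, rfl⟩ := exists_germ g
    have h : A.act s ⟨x, hs⟩ ∈ A.dom (s * star s) :=
      (A.mem_dom_star_mul (star s) _).2 (A.act_mem s ⟨x, hs⟩)
    have h1 : A.one (A.r (germ s x hs)) = germ (s * star s) (A.act s ⟨x, hs⟩) h :=
      A.one_eq (idem_mul_star s) _ h
    refine Eq.trans ?_ ((A.mul_germ (s * star s) s _ x h hs rfl).trans
      (A.germ_congr (mul_star_mul s) rfl))
    congr 1
  mul_one g := by
    obtain ⟨s, x, hs, rfl⟩ := exists_germ g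
    have h : x ∈ A.dom (star s * s) := (A.mem_dom_star_mul s _).2 hs
    have h1 : A.one (A.d (germ s x hs)) = germ (star s * s) x h := A.one_eq (idem_star_mul s) _ h
    refine Eq.trans ?_ ((A.mul_germ s (star s * s) x x hs h
      (A.act_idem (idem_star_mul s) x h).symm).trans
        (A.germ_congr (by rw [← mul_assoc, mul_star_mul]) rfl))
    congr 1
  mul_assoc g h k e e' := by
    obtain ⟨s, x, hs, rfl⟩ := exists_germ g
    obtain ⟨t, y, ht, rfl⟩ := exists_germ h
    obtain ⟨a, z, ha, rfl⟩ := exists_germ k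
    have e1 : y = A.act a ⟨z, ha⟩ := e'
    have e2 : x = A.act t ⟨y, ht⟩ := e
    have hst : y ∈ A.dom (s * t) := (A.mem_dom_mul s t y).2 ⟨ht, e2 ▸ hs⟩
    have hta : z ∈ A.dom (t * a) := (A.mem_dom_mul t a z).2 ⟨ha, e1 ▸ ht⟩
    have e3 : x = A.act (t * a) ⟨z, hta⟩ := by
      rw [A.act_mul t a z hta ha (e1 ▸ ht), e2]
      exact A.act_congr rfl _ e1
    trans A.mul (germ (s * t) y hst) (germ a z ha) e1
    · congr 1
      exact A.mul_germ s t x y hs ht e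
    trans A.mul (germ s x hs) (germ (t * a) z hta) e3
    · rw [A.mul_germ _ _ _ _ _ _ e1, A.mul_germ _ _ _ _ _ _ e3]
      exact A.germ_congr (mul_assoc _ _ _) rfl
    · congr 1
      exact (A.mul_germ t a y z ht ha e').symm
  inv_mul g := by
    obtain ⟨s, x, hs, rfl⟩ := exists_germ g
    have h : x ∈ A.dom (star s * s) := (A.mem_dom_star_mul s _).2 hs
    exact (A.mul_germ (star s) s _ x (A.act_mem s ⟨x, hs⟩) hs rfl).trans
      (A.one_eq (idem_star_mul s) x h).symm
  mul_inv g := by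
    obtain ⟨s, x, hs, rfl⟩ := exists_germ g
    have h : A.act s ⟨x, hs⟩ ∈ A.dom (s * star s) :=
      (A.mem_dom_star_mul (star s) _).2 (A.act_mem s ⟨x, hs⟩)
    exact (A.mul_germ s (star s) x _ hs (A.act_mem s ⟨x, hs⟩) (A.act_star s ⟨x, hs⟩).symm).trans
      (A.one_eq (idem_mul_star s) _ h).symm
  continuous_d := A.continuous_d
  continuous_r := by
    rw [A.r_eq]
    exact A.continuous_d.comp A.continuous_inv
  continuous_one := A.continuous_one
  continuous_inv := A.continuous_inv
  continuous_mul := A.continuous_mul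

end InvAction

end Germs

/-! ### Filters of idempotents and the tight groupoid of an inverse semigroup -/

section Filters

variable {X : Type*}

/-- A (proper) filter of idempotents of `S`: a nonempty set of nonzero idempotents which is
upward closed (`e ≤ f` means `e = e f`) and closed under products. -/
structure IdemFilter (S : InverseSubsemigroup X) where
  carrier : Set S
  idem : ∀ e ∈ carrier, IsIdempotentElem e
  nonempty : carrier.Nonempty
  up : ∀ e ∈ carrier, ∀ f : S, IsIdempotentElem f → e = e * f → f ∈ carrier
  mul_mem : ∀ e ∈ carrier, ∀ f ∈ carrier, e * f ∈ carrier
  ne_zero : ∀ e ∈ carrier, (e : X ≃. X) ≠ ⊥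

variable {S : InverseSubsemigroup X}

namespace IdemFilter

instance : SetLike (IdemFilter S) S where
  coe η := η.carrier
  coe_injective η ξ h := by
    cases η; cases ξ
    congr

variable (S) in
/-- `U(X, Y)`: the filters which contain `P` and are disjoint from `Q`. -/
def basicOpen (P Q : Set S) : Set (IdemFilter S) := {η | P ⊆ η ∧ Disjoint Q η}

/-- The topology with basis the sets `U(P, Q)`, for finite sets `P`, `Q` of idempotents. -/
instance : TopologicalSpace (IdemFilter S) :=
  TopologicalSpace.generateFrom {W | ∃ P Q : Set S, P.Finite ∧ Q.Finite ∧
    (∀ e ∈ P, IsIdempotentElem e) ∧ (∀ e ∈ Q, IsIdempotentElem e) ∧ W = basicOpen S P Q}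

theorem isOpen_basicOpen {P Q : Set S} (hP : P.Finite) (hQ : Q.Finite)
    (hP' : ∀ e ∈ P, IsIdempotentElem e) (hQ' : ∀ e ∈ Q, IsIdempotentElem e) :
    IsOpen (basicOpen S P Q) :=
  TopologicalSpace.isOpen_generateFrom_of_mem ⟨P, Q, hP, hQ, hP', hQ', rfl⟩

/-- An ultrafilter is a filter not properly contained in another filter. -/
def IsUltra (η : IdemFilter S) : Prop :=
  ∀ ξ : IdemFilter S, (η : Set S) ⊆ ξ → (ξ : Set S) ⊆ η

variable (S) in
/-- The set of tight filters: the closure of the set of ultrafilters. -/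
def tight : Set (IdemFilter S) := closure {η | IsUltra η}

theorem sandwich_le {p f : S} (hp : IsIdempotentElem p) (hf : IsIdempotentElem f) :
    p * f * p = p * f * p * f := by
  rw [mul_assoc p f p, idem_comm hf hp, ← mul_assoc, hp.eq, mul_assoc, hf.eq]

theorem conj_le (s : S) {e f : S} (he : IsIdempotentElem e)
    (h : s * e * star s = s * e * star s * f) :
    e * (star s * s) = e * (star s * s) * (star s * f * s) := by
  have h1 : star s * (s * e * star s) * s = e * (star s * s) := by
    have : star s * (s * e * star s) * s = (star s * s) * e * (star s * s) := by
      simp only [mul_assoc]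
    rw [this, ← idem_comm he (idem_star_mul s), mul_assoc, (idem_star_mul s).eq]
  have h2 : star s * (s * e * star s * f) * s = e * (star s * s) * (star s * f * s) := by
    have : star s * (s * e * star s * f) * s = (star s * s) * e * (star s * f * s) := by
      simp only [mul_assoc]
    rw [this, idem_comm (idem_star_mul s) he]
  rw [← h2, ← h, h1]

theorem conj_idem_le {e f : S} (s : S) (he : IsIdempotentElem e) (h : e = e * f) :
    star s * e * s = star s * e * s * (star s * f * s) := by
  have : star s * e * s * (star s * f * s) = star s * e * (s * star s) * f * s := by
    simp only [mul_assoc]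
  rw [this, mul_mul_star_comm s he, mul_assoc (star s) e f, ← h]

/-- Membership in `s · η`. -/
theorem mem_act_iff (s : S) (η : IdemFilter S) (hs : star s * s ∈ η) {f : S}
    (hf : IsIdempotentElem f) :
    (∃ e ∈ η, s * e * star s = s * e * star s * f) ↔ star s * f * s ∈ η := by
  constructor
  · rintro ⟨e, he, h⟩
    exact η.up _ (η.mul_mem e he _ hs) _ (idem_conj s hf)
      (conj_le s (η.idem e he) h)
  · intro h
    refine ⟨_, h, ?_⟩
    have h1 : s * (star s * f * s) * star s = (s * star s) * f * (s * star s) := by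
      simp only [mul_assoc]
    rw [h1]
    exact sandwich_le (idem_mul_star s) hf

/-- `s · η = {f : s e s⋆ ≤ f for some e ∈ η}`, for `s⋆ s ∈ η`. -/
def act (s : S) (η : IdemFilter S) (hs : star s * s ∈ η) : IdemFilter S where
  carrier := {f | IsIdempotentElem f ∧ ∃ e ∈ η, s * e * star s = s * e * star s * f}
  idem f hf := hf.1
  nonempty := by
    refine ⟨s * star s, idem_mul_star s, (mem_act_iff s η hs (idem_mul_star s)).2 ?_⟩
    rw [mul_assoc, mul_star_mul]
    exact hs
  up e he f hf h := by
    refine ⟨hf, (mem_act_iff s η hs hf).2 ?_⟩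
    exact η.up _ ((mem_act_iff s η hs he.1).1 he.2) _ (idem_conj s hf)
      (conj_idem_le s he.1 h)
  mul_mem e he f hf := by
    refine ⟨idem_mul he.1 hf.1, (mem_act_iff s η hs (idem_mul he.1 hf.1)).2 ?_⟩
    have h1 := η.mul_mem _ ((mem_act_iff s η hs he.1).1 he.2) _
      ((mem_act_iff s η hs hf.1).1 hf.2)
    have : star s * e * s * (star s * f * s) = star s * e * (s * star s) * f * s := by
      simp only [mul_assoc]
    rwa [this, mul_mul_star_comm s he.1, mul_assoc (star s)] at h1
  ne_zero f hf h := by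
    refine η.ne_zero _ ((mem_act_iff s η hs hf.1).1 hf.2) ?_
    change star s.1 * f.1 * s.1 = ⊥
    rw [h]
    apply mem_ext
    intro a b
    constructor
    · intro h1
      obtain ⟨c, -, h2⟩ := mem_mul.1 h1
      obtain ⟨e, h3, -⟩ := mem_mul.1 h2
      cases h3
    · intro h1
      cases h1

theorem mem_act {s : S} {η : IdemFilter S} {hs : star s * s ∈ η} {f : S} :
    f ∈ act s η hs ↔ IsIdempotentElem f ∧ star s * f * s ∈ η :=
  and_congr_right fun hf => mem_act_iff s η hs hf

theorem mem_dom_mul (s t : S) (η : IdemFilter S) :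
    star (s * t) * (s * t) ∈ η ↔ ∃ h : star t * t ∈ η, star s * s ∈ act t η h := by
  have h1 : star (s * t) * (s * t) = star t * (star s * s) * t := by
    simp only [star_mul', mul_assoc]
  rw [h1]
  constructor
  · intro h
    have ht : star t * t ∈ η := by
      refine η.up _ h _ (idem_star_mul t) ?_
      rw [mul_assoc _ t, ← mul_assoc t, mul_star_mul]
    exact ⟨ht, mem_act.2 ⟨idem_star_mul s, h⟩⟩
  · rintro ⟨h, h'⟩
    exact (mem_act.1 h').2

theorem act_mul (s t : S) (η : IdemFilter S) (h) (h₁) (h₂) :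
    act (s * t) η h = act s (act t η h₁) h₂ := by
  apply SetLike.ext
  intro f
  rw [mem_act, mem_act, mem_act]
  have : star (s * t) * f * (s * t) = star t * (star s * f * s) * t := by
    simp only [star_mul', mul_assoc]
  rw [this]
  exact ⟨fun h => ⟨h.1, idem_conj s h.1, h.2⟩, fun h => ⟨h.1, h.2.2⟩⟩

theorem act_mem (s : S) (η : IdemFilter S) (h : star s * s ∈ η) :
    star (star s) * star s ∈ act s η h := by
  rw [mem_act, star_star', mul_assoc, mul_star_mul]
  exact ⟨idem_mul_star s, h⟩

theorem act_star (s : S) (η : IdemFilter S) (h : star s * s ∈ η) :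
    act (star s) (act s η h) (act_mem s η h) = η := by
  apply SetLike.ext
  intro f
  rw [mem_act, mem_act]
  have key : ∀ hf : IsIdempotentElem f,
      star s * (star (star s) * f * star s) * s = (star s * s) * f * (star s * s) := by
    intro hf
    simp only [star_star', mul_assoc]
  constructor
  · rintro ⟨hf, -, h2⟩
    rw [key hf] at h2
    refine η.up _ h2 _ hf ?_
    exact sandwich_le (idem_star_mul s) hf
  · intro hf
    have hf' := η.idem f hf
    refine ⟨hf', idem_conj (star s) hf', ?_⟩
    rw [key hf']
    exact η.mul_mem _ (η.mul_mem _ h _ hf) _ h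

theorem act_mono (s : S) {η ξ : IdemFilter S} (h) (h') (hle : (η : Set S) ⊆ ξ) :
    (act s η h : Set S) ⊆ act s ξ h' := fun _ hf =>
  mem_act.2 ⟨(mem_act.1 hf).1, hle (mem_act.1 hf).2⟩

theorem act_ultra (s : S) (η : IdemFilter S) (h : star s * s ∈ η) (hη : IsUltra η) :
    IsUltra (act s η h) := by
  intro ξ hξ
  have hs : star (star s) * star s ∈ ξ := hξ (act_mem s η h)
  have h1 : (η : Set S) ⊆ act (star s) ξ hs := by
    have := act_mono (star s) (act_mem s η h) hs hξ
    rwa [act_star] at this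
  have h2 := hη _ h1
  have h3 := act_mono s (act_mem (star s) ξ hs) h h2
  have h4 : act s (act (star s) ξ hs) (act_mem (star s) ξ hs) = ξ := act_star (star s) ξ hs
  rwa [h4] at h3

theorem isOpen_dom (s : S) : IsOpen {η : IdemFilter S | star s * s ∈ η} := by
  have : {η : IdemFilter S | star s * s ∈ η} = basicOpen S {star s * s} ∅ := by
    ext η
    simp [basicOpen]
  rw [this]
  exact isOpen_basicOpen (finite_singleton _) finite_empty
    (by rintro _ rfl; exact idem_star_mul s) (by simp)

theorem continuous_act (s : S) :
    Continuous fun η : {η : IdemFilter S | star s * s ∈ η} => act s η.1 η.2 := by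
  apply continuous_generateFrom_iff.2
  rintro _ ⟨P, Q, hP, hQ, hP', hQ', rfl⟩
  have : (fun η : {η : IdemFilter S | star s * s ∈ η} => act s η.1 η.2) ⁻¹' basicOpen S P Q =
      Subtype.val ⁻¹' basicOpen S ((fun f => star s * f * s) '' P)
        ((fun f => star s * f * s) '' Q) := by
    ext ⟨η, h⟩
    simp only [basicOpen, mem_preimage, Set.mem_ofPred_eq, subset_def, Set.disjoint_left,
      forall_mem_image, SetLike.mem_coe, mem_act]
    refine and_congr ?_ ?_
    · exact forall₂_congr fun f hf => and_iff_right (hP' f hf)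
    · exact forall₂_congr fun f hf => not_congr (and_iff_right (hQ' f hf))
  rw [this]
  refine IsOpen.preimage continuous_subtype_val
    (isOpen_basicOpen (hP.image _) (hQ.image _) ?_ ?_)
  · rintro _ ⟨f, hf, rfl⟩
    exact idem_conj s (hP' f hf)
  · rintro _ ⟨f, hf, rfl⟩
    exact idem_conj s (hQ' f hf)

theorem act_tight (s : S) (η : IdemFilter S) (h : star s * s ∈ η) (hη : η ∈ tight S) :
    act s η h ∈ tight S := by
  have h1 : (⟨η, h⟩ : {η : IdemFilter S | star s * s ∈ η}) ∈
      closure (Subtype.val ⁻¹' {η | IsUltra η}) :=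
    ((isOpen_dom s).isOpenMap_subtype_val.preimage_closure_eq_closure_preimage
      continuous_subtype_val {η : IdemFilter S | IsUltra η}).subset hη
  refine closure_mono ?_ (image_closure_subset_closure_image (continuous_act s)
    ⟨_, h1, rfl⟩)
  rintro _ ⟨⟨ξ, hξ⟩, hu, rfl⟩
  exact act_ultra s ξ hξ hu

end IdemFilter

variable (S) in
/-- The standard action of `S` on its space of tight filters. -/
def tightAction : InvAction S (IdemFilter.tight S) where
  dom s := {η | star s * s ∈ η.1}
  act s η := ⟨IdemFilter.act s η.1.1 η.2, IdemFilter.act_tight s η.1.1 η.2 η.1.2⟩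
  mem_dom_mul s t η := IdemFilter.mem_dom_mul s t η.1
  act_mul s t η h h₁ h₂ := Subtype.ext (IdemFilter.act_mul s t η.1 h h₁ h₂)
  act_mem s η := IdemFilter.act_mem s η.1.1 η.2
  act_star s η := Subtype.ext (IdemFilter.act_star s η.1.1 η.2)
  cover η := by
    obtain ⟨e, he⟩ := η.1.nonempty
    refine ⟨e, ?_⟩
    change star e * e ∈ η.1
    rw [idem_star (η.1.idem e he), (η.1.idem e he).eq]
    exact he
  isOpen_dom s := (IdemFilter.isOpen_dom s).preimage continuous_subtype_val
  continuous_act s := by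
    refine Continuous.subtype_mk ?_ _
    exact (IdemFilter.continuous_act s).comp
      (f := fun η : {η : IdemFilter.tight S | star s * s ∈ η.1} => ⟨η.1.1, η.2⟩)
      (by fun_prop)

variable (S) in
/-- The tight groupoid `G_tight(S)` of an inverse semigroup `S`. -/
def tightGroupoid : TopGroupoid (tightAction S).Germ (IdemFilter.tight S) :=
  (tightAction S).groupoid

end Filters

/-! ### Small categories, viewed through their sets of morphisms -/

section SmallCategory

variable (C : Type u) [Category.{v} C]

/-- The set of morphisms of a small category. For composable `α`, `β` (that is `s(α) = r(β)`), the
product `α β` is the composite "`β` first, then `α`", so `β ≫ α` in Mathlib's notation. -/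
structure Mor where
  src : C
  tgt : C
  hom : src ⟶ tgt

/-- Left cancellation: `α β = α γ` implies `β = γ`, i.e. all morphisms are monomorphisms. -/
class LeftCancellative : Prop where
  mono : ∀ {x y : C} (α : x ⟶ y), Mono α

/-- Right cancellation: `β α = γ α` implies `β = γ`, i.e. all morphisms are epimorphisms. -/
class RightCancellative : Prop where
  epi : ∀ {x y : C} (α : x ⟶ y), Epi α

variable {C}

/-- `α ≤ β` iff `β` extends `α`, i.e. `β = α γ` for some `γ`. Hence `Ici α` is the right ideal
`α Λ` and `Iic β` is the set `[β]` of initial segments of `β`. -/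
instance : Preorder (Mor C) where
  le α β := ∃ (x : C) (γ : x ⟶ α.src), β = ⟨x, α.tgt, γ ≫ α.hom⟩
  le_refl α := ⟨α.src, 𝟙 _, by rw [Category.id_comp]⟩
  le_trans α β γ := by
    rintro ⟨x, f, rfl⟩ ⟨y, g, rfl⟩
    exact ⟨y, g ≫ f, by rw [Category.assoc]⟩

/-- `α ⋒ β`: the morphisms `α` and `β` have a common extension. -/
def Meets (α β : Mor C) : Prop := (Ici α ∩ Ici β).Nonempty

variable (C) in
/-- `Λ` is finitely aligned if each `α Λ ∩ β Λ` is a finite union of sets `γ Λ`. -/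
def FinitelyAligned : Prop :=
  ∀ α β : Mor C, ∃ Γ : Set (Mor C), Γ.Finite ∧ Ici α ∩ Ici β = ⋃ γ ∈ Γ, Ici γ

section Tau

open Classical in
/-- The partial bijection with a given graph. -/
def ofGraph {X : Type*} (R : X → X → Prop) (h₁ : ∀ a b b', R a b → R a b' → b = b')
    (h₂ : ∀ a a' b, R a b → R a' b → a = a') : X ≃. X where
  toFun a := if h : ∃ b, R a b then some h.choose else none
  invFun b := if h : ∃ a, R a b then some h.choose else none
  inv a b := by
    have e₁ : ((if h : ∃ a, R a b then some h.choose else none) = some a) ↔ R a b := by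
      split_ifs with h
      · rw [Option.some_inj]
        exact ⟨fun e => e ▸ h.choose_spec, fun e => h₂ _ _ _ h.choose_spec e⟩
      · exact ⟨fun e => (by cases e), fun e => (h ⟨a, e⟩).elim⟩
    have e₂ : ((if h : ∃ b, R a b then some h.choose else none) = some b) ↔ R a b := by
      split_ifs with h
      · rw [Option.some_inj]
        exact ⟨fun e => e ▸ h.choose_spec, fun e => h₁ _ _ _ h.choose_spec e⟩
      · exact ⟨fun e => (by cases e), fun e => (h ⟨b, e⟩).elim⟩
    rw [e₁, e₂]

open Classical in
theorem mem_ofGraph {X : Type*} {R : X → X → Prop} {h₁ : ∀ a b b', R a b → R a b' → b = b'}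
    {h₂ : ∀ a a' b, R a b → R a' b → a = a'} {a b : X} : b ∈ ofGraph R h₁ h₂ a ↔ R a b := by
  change ((if h : ∃ b, R a b then some h.choose else none) = some b) ↔ R a b
  split_ifs with h
  · rw [Option.some_inj]
    exact ⟨fun e => e ▸ h.choose_spec, fun e => h₁ _ _ _ h.choose_spec e⟩
  · exact ⟨fun e => (by cases e), fun e => (h ⟨b, e⟩).elim⟩

variable [LeftCancellative C]

/-- The partial bijection `τ^α : s(α) Λ → α Λ`, `β ↦ α β`. -/
def tau (α : Mor C) : Mor C ≃. Mor C :=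
  ofGraph (fun β γ => ∃ (x : C) (δ : x ⟶ α.src), β = ⟨x, α.src, δ⟩ ∧ γ = ⟨x, α.tgt, δ ≫ α.hom⟩)
    (by
      rintro a b b' ⟨x, δ, rfl, rfl⟩ ⟨x', δ', h, rfl⟩
      cases h
      rfl)
    (by
      rintro a a' b ⟨x, δ, rfl, rfl⟩ ⟨x', δ', rfl, h⟩
      have := LeftCancellative.mono α.hom
      injection h with h1 h2 h3
      subst h1
      rw [cancel_mono α.hom |>.1 (eq_of_heq h3)])

/-- The partial bijection `σ^α : α Λ → s(α) Λ`, `α β ↦ β`. -/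
def sigma (α : Mor C) : Mor C ≃. Mor C := star (tau α)

variable (C) in
/-- The inverse semigroup `S_Λ` of partial bijections of `Λ` generated by all `σ^α` and `τ^α`. -/
def semigroupOf : InverseSubsemigroup (Mor C) where
  toSubsemigroup := Subsemigroup.closure (range (sigma (C := C)) ∪ range (tau (C := C)))
  star_mem' f hf := by
    induction hf using Subsemigroup.closure_induction with
    | mem x hx =>
      rcases hx with ⟨α, rfl⟩ | ⟨α, rfl⟩
      · exact Subsemigroup.subset_closure (Or.inr ⟨α, rfl⟩)
      · exact Subsemigroup.subset_closure (Or.inl ⟨α, rfl⟩)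
    | mul x y _ _ hx hy => exact (Subsemigroup.closure _).mul_mem hy hx

/-- Elements of `S_Λ` commute with right multiplication. -/
theorem equivariant (s : semigroupOf C) : ∀ γ γ' : Mor C, γ' ∈ s.1 γ →
    ∃ (x y y' : C) (f : x ⟶ y) (f' : x ⟶ y'), γ = ⟨x, y, f⟩ ∧ γ' = ⟨x, y', f'⟩ ∧
      ∀ (z : C) (δ : z ⟶ x), (⟨z, y', δ ≫ f'⟩ : Mor C) ∈ s.1 ⟨z, y, δ ≫ f⟩ := by
  obtain ⟨s, hs⟩ := s
  change s ∈ Subsemigroup.closure _ at hs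
  dsimp only
  induction hs using Subsemigroup.closure_induction with
  | mem s hs =>
    rcases hs with ⟨α, rfl⟩ | ⟨α, rfl⟩
    · intro γ γ' h
      obtain ⟨x, δ, rfl, rfl⟩ := mem_ofGraph.1 (mem_star.1 h)
      refine ⟨x, _, _, _, _, rfl, rfl, fun z ε => mem_star.2 (mem_ofGraph.2 ?_)⟩
      exact ⟨z, ε ≫ δ, rfl, by rw [Category.assoc]⟩
    · intro γ γ' h
      obtain ⟨x, δ, rfl, rfl⟩ := mem_ofGraph.1 h
      refine ⟨x, _, _, _, _, rfl, rfl, fun z ε => mem_ofGraph.2 ?_⟩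
      exact ⟨z, ε ≫ δ, rfl, by rw [Category.assoc]⟩
  | mul s t _ _ hs ht =>
    intro γ γ' h
    obtain ⟨β, h1, h2⟩ := mem_mul.1 h
    obtain ⟨x, y, y', f, f', rfl, rfl, h3⟩ := ht _ _ h1
    obtain ⟨x₁, y₁, y₁', g, g', h4, rfl, h5⟩ := hs _ _ h2
    cases h4
    exact ⟨x, y, y₁', f, g', rfl, rfl, fun z δ => mem_mul.2 ⟨_, h3 z δ, h5 z δ⟩⟩

theorem lift_le (s : semigroupOf C) {γ γ' δ : Mor C} (h : γ' ∈ s.1 γ) (hle : γ ≤ δ) :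
    ∃ δ', δ' ∈ s.1 δ ∧ γ' ≤ δ' := by
  obtain ⟨x, y, y', f, f', rfl, rfl, h1⟩ := equivariant s γ γ' h
  obtain ⟨z, ε, rfl⟩ := hle
  exact ⟨_, h1 z ε, z, ε, rfl⟩

theorem lift_le' (s : semigroupOf C) {γ γ' δ' : Mor C} (h : γ' ∈ s.1 γ) (hle : γ' ≤ δ') :
    ∃ δ, δ' ∈ s.1 δ ∧ γ ≤ δ := by
  obtain ⟨δ, h1, h2⟩ := lift_le (star s) (mem_star.2 h) hle
  exact ⟨δ, mem_star.1 h1, h2⟩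

theorem le_of_mem (s : semigroupOf C) {γ γ' δ δ' : Mor C} (h : γ' ∈ s.1 γ) (h' : δ' ∈ s.1 δ)
    (hle : γ ≤ δ) : γ' ≤ δ' := by
  obtain ⟨ε, h1, h2⟩ := lift_le s h hle
  rwa [Option.mem_unique h' h1]

theorem le_of_mem' (s : semigroupOf C) {γ γ' δ δ' : Mor C} (h : γ' ∈ s.1 γ) (h' : δ' ∈ s.1 δ)
    (hle : γ' ≤ δ') : γ ≤ δ := le_of_mem (star s) (mem_star.2 h) (mem_star.2 h') hle

end Tau

/-! ### Hereditary directed sets of morphisms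

The space `Λ*` of nonempty, hereditary, (upwards) directed subsets of `Λ` is the space of order
ideals of `(Λ, ≤)`. -/

namespace Paths

/-- `M^{P, Q}`: the hereditary directed sets which contain `P` and are disjoint from `Q`. -/
def basicOpen (P Q : Set (Mor C)) : Set (Order.Ideal (Mor C)) := {F | P ⊆ F ∧ Disjoint Q F}

/-- The topology of `Λ*` with basis the sets `M^{P, Q}`, for `P`, `Q` finite. -/
instance : TopologicalSpace (Order.Ideal (Mor C)) :=
  TopologicalSpace.generateFrom
    {W | ∃ P Q : Set (Mor C), P.Finite ∧ Q.Finite ∧ W = basicOpen P Q}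

theorem isOpen_basicOpen {P Q : Set (Mor C)} (hP : P.Finite) (hQ : Q.Finite) :
    IsOpen (basicOpen P Q) :=
  TopologicalSpace.isOpen_generateFrom_of_mem ⟨P, Q, hP, hQ, rfl⟩

theorem isOpen_mem (γ : Mor C) : IsOpen {F : Order.Ideal (Mor C) | γ ∈ F} := by
  have : {F : Order.Ideal (Mor C) | γ ∈ F} = basicOpen {γ} ∅ := by
    ext F
    simp [basicOpen]
  rw [this]
  exact isOpen_basicOpen (finite_singleton _) finite_empty

/-- `Z` is an exhaustive subset of `A`: every element of `A` has a common extension with some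
element of `Z`. -/
def IsExhaustive (Z A : Set (Mor C)) : Prop := Z ⊆ A ∧ ∀ γ ∈ A, ∃ ζ ∈ Z, Meets ζ γ

/-- `F ∈ Λ*` is tight if for all `α ∈ F` and all finite `B` disjoint from `F`, `F` meets every
finite exhaustive subset of `α Λ ∖ ⋃ β ∈ B, β Λ`. -/
def IsTight (F : Order.Ideal (Mor C)) : Prop :=
  ∀ α ∈ F, ∀ B : Set (Mor C), B.Finite → Disjoint B (F : Set (Mor C)) →
    ∀ Z : Set (Mor C), Z.Finite → IsExhaustive Z (Ici α \ ⋃ β ∈ B, Ici β) →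
      ((F : Set (Mor C)) ∩ Z).Nonempty

variable (C) in
/-- The space `Λ_tight` of tight hereditary directed sets. -/
def tight : Set (Order.Ideal (Mor C)) := {F | IsTight F}

theorem isTight_iff (hC : FinitelyAligned C) (F : Order.Ideal (Mor C)) :
    IsTight F ↔ ∀ α ∈ F, ∀ Z : Set (Mor C), Z.Finite → IsExhaustive Z (Ici α) →
      ∃ ζ ∈ Z, ζ ∈ F := by
  constructor
  · intro h α hα Z hZ hex
    obtain ⟨ζ, h1, h2⟩ := h α hα ∅ finite_empty (by simp) Z hZ (by simpa using hex)
    exact ⟨ζ, h2, h1⟩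
  · intro h α hα B hB hBF Z hZ hex
    choose Γ hΓ hΓ' using fun β => hC α β
    obtain ⟨ζ, h1, h2⟩ := h α hα (Z ∪ ⋃ β ∈ B, Γ β) (hZ.union (hB.biUnion fun β _ => hΓ β)) (by
      constructor
      · rintro ζ (hζ | hζ)
        · exact (hex.1 hζ).1
        · obtain ⟨β, hβ, hζ⟩ := mem_iUnion₂.1 hζ
          have : ζ ∈ Ici α ∩ Ici β := by
            rw [hΓ']
            exact mem_iUnion₂.2 ⟨ζ, hζ, mem_Ici.2 le_rfl⟩
          exact this.1
      · intro γ hγ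
        by_cases hγB : γ ∈ ⋃ β ∈ B, Ici β
        · obtain ⟨β, hβ, hγβ⟩ := mem_iUnion₂.1 hγB
          have : γ ∈ Ici α ∩ Ici β := ⟨hγ, hγβ⟩
          rw [hΓ'] at this
          obtain ⟨ζ, hζ, hζγ⟩ := mem_iUnion₂.1 this
          exact ⟨ζ, Or.inr (mem_iUnion₂.2 ⟨β, hβ, hζ⟩), γ, hζγ, mem_Ici.2 le_rfl⟩
        · obtain ⟨ζ, hζ, hm⟩ := hex.2 γ ⟨hγ, hγB⟩
          exact ⟨ζ, Or.inl hζ, hm⟩)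
    rcases h1 with h1 | h1
    · exact ⟨ζ, h2, h1⟩
    · obtain ⟨β, hβ, hζ⟩ := mem_iUnion₂.1 h1
      have : ζ ∈ Ici α ∩ Ici β := by
        rw [hΓ']
        exact mem_iUnion₂.2 ⟨ζ, hζ, mem_Ici.2 le_rfl⟩
      exact (Set.disjoint_left.1 hBF hβ (F.lower this.2 h2)).elim

variable [LeftCancellative C]

/-- The domain of the action of `s ∈ S_Λ` on `Λ*`: those `F` which meet the domain of the partial
bijection `s`. For `s = ⋁ τ^{α_i} σ^{β_i}` these are the `F` which contain some `β_i`. -/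
def dom (s : semigroupOf C) : Set (Order.Ideal (Mor C)) := {F | ∃ γ ∈ F, ∃ γ', γ' ∈ s.1 γ}

/-- The action of `S_Λ` on `Λ*`: `s · F` consists of the initial segments of all `s(γ)`, for `γ ∈ F`
in the domain of `s`. For `s = τ^α σ^β` this is `⋃ [α σ^β(γ)]` over all `γ ∈ F` with `β ≤ γ`. -/
def act (s : semigroupOf C) (F : Order.Ideal (Mor C)) (hF : F ∈ dom s) : Order.Ideal (Mor C) where
  carrier := {δ | ∃ γ ∈ F, ∃ γ', γ' ∈ s.1 γ ∧ δ ≤ γ'}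
  lower' := by
    rintro δ ε hle ⟨γ, hγ, γ', h, h'⟩
    exact ⟨γ, hγ, γ', h, hle.trans h'⟩
  nonempty' := by
    obtain ⟨γ, hγ, γ', h⟩ := hF
    exact ⟨γ', γ, hγ, γ', h, le_rfl⟩
  directed' := by
    rintro δ₁ ⟨γ₁, hγ₁, γ₁', h₁, h₁'⟩ δ₂ ⟨γ₂, hγ₂, γ₂', h₂, h₂'⟩
    obtain ⟨γ, hγ, l₁, l₂⟩ := F.directed γ₁ hγ₁ γ₂ hγ₂
    obtain ⟨γ', h, l⟩ := lift_le s h₁ l₁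
    exact ⟨γ', ⟨γ, hγ, γ', h, le_rfl⟩, h₁'.trans l, h₂'.trans (le_of_mem s h₂ h l₂)⟩

theorem mem_act {s : semigroupOf C} {F : Order.Ideal (Mor C)} {hF : F ∈ dom s} {δ : Mor C} :
    δ ∈ act s F hF ↔ ∃ γ ∈ F, ∃ γ', γ' ∈ s.1 γ ∧ δ ≤ γ' := Iff.rfl

theorem mem_dom_mul (s t : semigroupOf C) (F : Order.Ideal (Mor C)) :
    F ∈ dom (s * t) ↔ ∃ h : F ∈ dom t, act t F h ∈ dom s := by
  constructor
  · rintro ⟨γ, hγ, γ', h⟩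
    obtain ⟨β, h1, h2⟩ := mem_mul.1 h
    exact ⟨⟨γ, hγ, β, h1⟩, β, ⟨γ, hγ, β, h1, le_rfl⟩, γ', h2⟩
  · rintro ⟨-, δ, ⟨γ, hγ, β, h1, h2⟩, δ', h3⟩
    obtain ⟨γ', h4, -⟩ := lift_le s h3 h2
    exact ⟨γ, hγ, γ', mem_mul.2 ⟨β, h1, h4⟩⟩

theorem act_mul (s t : semigroupOf C) (F : Order.Ideal (Mor C)) (h) (h₁) (h₂) :
    act (s * t) F h = act s (act t F h₁) h₂ := by
  apply SetLike.ext
  intro δ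
  rw [mem_act, mem_act]
  constructor
  · rintro ⟨γ, hγ, γ', h3, h4⟩
    obtain ⟨β, h5, h6⟩ := mem_mul.1 h3
    exact ⟨β, ⟨γ, hγ, β, h5, le_rfl⟩, γ', h6, h4⟩
  · rintro ⟨ε, ⟨γ, hγ, β, h3, h4⟩, ε', h5, h6⟩
    obtain ⟨γ', h7, h8⟩ := lift_le s h5 h4
    exact ⟨γ, hγ, γ', mem_mul.2 ⟨β, h3, h7⟩, h6.trans h8⟩

theorem act_mem (s : semigroupOf C) (F : Order.Ideal (Mor C)) (h : F ∈ dom s) :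
    act s F h ∈ dom (star s) := by
  obtain ⟨γ, hγ, γ', h1⟩ := h
  exact ⟨γ', ⟨γ, hγ, γ', h1, le_rfl⟩, γ, mem_star.2 h1⟩

theorem act_star (s : semigroupOf C) (F : Order.Ideal (Mor C)) (h : F ∈ dom s) :
    act (star s) (act s F h) (act_mem s F h) = F := by
  apply SetLike.ext
  intro δ
  rw [mem_act]
  constructor
  · rintro ⟨η, ⟨γ, hγ, γ', h1, h2⟩, δ', h3, h4⟩
    exact F.lower (h4.trans (le_of_mem' s (mem_star.1 h3) h1 h2)) hγ
  · intro hδ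
    obtain ⟨γ, hγ, γ', h1⟩ := h
    obtain ⟨ε, hε, l1, l2⟩ := F.directed γ hγ δ hδ
    obtain ⟨ε', h2, -⟩ := lift_le s h1 l1
    exact ⟨ε', ⟨ε, hε, ε', h2, le_rfl⟩, ε, mem_star.2 h2, l2⟩

theorem isOpen_dom (s : semigroupOf C) : IsOpen (dom s) := by
  rw [isOpen_iff_forall_mem_open]
  rintro F ⟨γ, hγ, γ', h⟩
  exact ⟨{F | γ ∈ F}, fun G hG => ⟨γ, hG, γ', h⟩, isOpen_mem γ, hγ⟩

theorem finite_pull (s : semigroupOf C) {Γ : Set (Mor C)} (hΓ : Γ.Finite) :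
    {ζ | ∃ ε ∈ Γ, ε ∈ s.1 ζ}.Finite := by
  have : {ζ | ∃ ε ∈ Γ, ε ∈ s.1 ζ} = ⋃ ε ∈ Γ, {ζ | ε ∈ s.1 ζ} := by
    ext ζ
    simp
  rw [this]
  refine hΓ.biUnion fun ε _ => Set.Subsingleton.finite ?_
  intro a ha b hb
  exact s.1.inj ha hb

theorem isOpen_mem_act (s : semigroupOf C) (δ : Mor C) :
    IsOpen {F : dom s | δ ∈ act s F.1 F.2} := by
  rw [isOpen_iff_forall_mem_open]
  rintro ⟨F, hF⟩ ⟨γ, hγ, γ', h, h'⟩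
  exact ⟨Subtype.val ⁻¹' {F | γ ∈ F}, fun G hG => ⟨γ, hG, γ', h, h'⟩,
    (isOpen_mem γ).preimage continuous_subtype_val, hγ⟩

theorem isOpen_notMem_act (hC : FinitelyAligned C) (s : semigroupOf C) (δ : Mor C) :
    IsOpen {F : dom s | δ ∉ act s F.1 F.2} := by
  rw [isOpen_iff_forall_mem_open]
  rintro ⟨F, hF⟩ hδ
  obtain ⟨γ, hγ, γ', h⟩ := id hF
  obtain ⟨Γ, hΓ, hΓ'⟩ := hC δ γ'
  have hle : ∀ ε ∈ Γ, ε ∈ Ici δ ∩ Ici γ' := by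
    intro ε hε
    rw [hΓ']
    exact mem_iUnion₂.2 ⟨ε, hε, mem_Ici.2 le_rfl⟩
  refine ⟨Subtype.val ⁻¹' basicOpen {γ} {ζ | ∃ ε ∈ Γ, ε ∈ s.1 ζ}, ?_,
    (isOpen_basicOpen (finite_singleton _) (finite_pull s hΓ)).preimage continuous_subtype_val,
    ?_⟩
  · rintro ⟨G, hG⟩ ⟨h1, h2⟩ ⟨η, hη, η', h3, h4⟩
    obtain ⟨κ, hκ, l1, l2⟩ := G.directed η hη γ (h1 rfl)
    obtain ⟨κ', h5, h6⟩ := lift_le s h3 l1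
    have : κ' ∈ Ici δ ∩ Ici γ' := ⟨h4.trans h6, le_of_mem s h h5 l2⟩
    rw [hΓ'] at this
    obtain ⟨ε, hε, hεκ⟩ := mem_iUnion₂.1 this
    obtain ⟨ζ, h7, -⟩ := lift_le' s h (hle ε hε).2
    exact Set.disjoint_left.1 h2 ⟨ε, hε, h7⟩ (G.lower (le_of_mem' s h7 h5 hεκ) hκ)
  · refine ⟨by rintro _ rfl; exact hγ, Set.disjoint_left.2 ?_⟩
    rintro ζ ⟨ε, hε, h1⟩ hζ
    exact hδ ⟨ζ, hζ, ε, h1, (hle ε hε).1⟩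

theorem continuous_act (hC : FinitelyAligned C) (s : semigroupOf C) :
    Continuous fun F : dom s => act s F.1 F.2 := by
  apply continuous_generateFrom_iff.2
  rintro _ ⟨P, Q, hP, hQ, rfl⟩
  have : (fun F : dom s => act s F.1 F.2) ⁻¹' basicOpen P Q =
      (⋂ δ ∈ P, {F : dom s | δ ∈ act s F.1 F.2}) ∩
        ⋂ δ ∈ Q, {F : dom s | δ ∉ act s F.1 F.2} := by
    ext F
    simp only [basicOpen, mem_preimage, mem_inter_iff, mem_iInter, Set.disjoint_left, subset_def]
    rfl
  rw [this]
  exact (hP.isOpen_biInter fun δ _ => isOpen_mem_act s δ).inter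
    (hQ.isOpen_biInter fun δ _ => isOpen_notMem_act hC s δ)

theorem act_tight (hC : FinitelyAligned C) (s : semigroupOf C) (F : Order.Ideal (Mor C))
    (hF : F ∈ dom s) (ht : F ∈ tight C) : act s F hF ∈ tight C := by
  refine (isTight_iff hC _).2 ?_
  rintro α ⟨γ, hγ, γ', h, hα⟩ Z hZ hex
  choose Γ hΓ hΓ' using fun ζ => hC ζ γ'
  have hle : ∀ z, ∀ ε ∈ Γ z, ε ∈ Ici z ∩ Ici γ' := by
    intro z ε hε
    rw [hΓ']
    exact mem_iUnion₂.2 ⟨ε, hε, mem_Ici.2 le_rfl⟩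
  obtain ⟨ζ, ⟨ε, hε, h1⟩, hζ⟩ := (isTight_iff hC F).1 ht γ hγ
    {ζ | ∃ ε ∈ ⋃ z ∈ Z, Γ z, ε ∈ s.1 ζ} (finite_pull s (hZ.biUnion fun z _ => hΓ z)) (by
      constructor
      · rintro ζ ⟨ε, hε, h1⟩
        obtain ⟨z, hz, hε⟩ := mem_iUnion₂.1 hε
        exact le_of_mem' s h h1 (hle z ε hε).2
      · intro η hη
        obtain ⟨η', h1, h2⟩ := lift_le s h hη
        obtain ⟨z, hz, κ', hκ1, hκ2⟩ := hex.2 η' (hα.trans h2)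
        have : κ' ∈ Ici z ∩ Ici γ' := ⟨hκ1, h2.trans hκ2⟩
        rw [hΓ'] at this
        obtain ⟨ε, hε, hεκ⟩ := mem_iUnion₂.1 this
        obtain ⟨ζ, h3, -⟩ := lift_le' s h (hle z ε hε).2
        obtain ⟨κ, h4, h5⟩ := lift_le' s h1 hκ2
        exact ⟨ζ, ⟨ε, mem_iUnion₂.2 ⟨z, hz, hε⟩, h3⟩, κ, le_of_mem' s h3 h4 hεκ, h5⟩)
  obtain ⟨z, hz, hε⟩ := mem_iUnion₂.1 hε
  exact ⟨z, hz, ζ, hζ, ε, h1, (hle z ε hε).1⟩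

end Paths

variable [LeftCancellative C]

/-- The action of `S_Λ` on `Λ_tight`, for `Λ` finitely aligned. -/
def pathAction (hC : FinitelyAligned C) : InvAction (semigroupOf C) (Paths.tight C) where
  dom s := {F | F.1 ∈ Paths.dom s}
  act s F := ⟨Paths.act s F.1.1 F.2, Paths.act_tight hC s F.1.1 F.2 F.1.2⟩
  mem_dom_mul s t F := Paths.mem_dom_mul s t F.1
  act_mul s t F h h₁ h₂ := Subtype.ext (Paths.act_mul s t F.1 h h₁ h₂)
  act_mem s F := Paths.act_mem s F.1.1 F.2
  act_star s F := Subtype.ext (Paths.act_star s F.1.1 F.2)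
  cover F := by
    obtain ⟨γ, hγ⟩ := F.1.nonempty
    refine ⟨⟨sigma γ, Subsemigroup.subset_closure (Or.inl ⟨γ, rfl⟩)⟩, γ, hγ,
      ⟨γ.src, γ.src, 𝟙 _⟩, mem_star.2 (mem_ofGraph.2 ⟨γ.src, 𝟙 _, rfl, ?_⟩)⟩
    rw [Category.id_comp]
  isOpen_dom s := (Paths.isOpen_dom s).preimage continuous_subtype_val
  continuous_act s := by
    refine Continuous.subtype_mk ?_ _
    exact (Paths.continuous_act hC s).comp
      (f := fun F : {F : Paths.tight C | F.1 ∈ Paths.dom s} => ⟨F.1.1, F.2⟩) (by fun_prop)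

/-- The groupoid of germs `S_Λ ⋉ Λ_tight`. -/
def pathGroupoid (hC : FinitelyAligned C) :
    TopGroupoid (pathAction hC).Germ (Paths.tight C) := (pathAction hC).groupoid

end SmallCategory

end TightGroupoid

end

/-! A germ records an element of the inverse semigroup, a point and an idempotent, so an equivariant
homeomorphism between the spaces of two actions of the same semigroup induces an isomorphism of
their groupoids of germs (`groupoidIso`). It therefore suffices to match tight filters with tight
hereditary directed sets equivariantly, and the Hausdorff property need only be proved for one of
the two groupoids.

An idempotent of `S_Λ` is the identity of its domain, and that domain is a right ideal. Finite
alignment makes this ideal a finite union of sets `γ Λ` (`exists_finite_idemDom`). The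
correspondence sends a tight filter `η` to the set of `γ` with `rangeIdem γ ∈ η`, and sends `F` to
the idempotents whose domain meets `F`. Its engine is `exists_rangeIdem_mem`: if a tight filter
contains `e`, and every element of the domain of `e` meets one of finitely many `ζ`, then the filter
contains some `rangeIdem ζ`. Maximality gives this for ultrafilters, and failure of the conclusion
is an open condition, so it passes to the closure. Applied to generators of `e`, it shows that `η`
is recovered from its set and that this set is directed; applied to exhaustive sets, it gives
tightness of the set. Conversely, tightness of `F` yields, for any basic neighbourhood of its
filter, some `γ` such that every ultrafilter containing `rangeIdem γ` lies in that neighbourhood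
(`toFilter_tight`).

For the Hausdorff property, germs with different sources are separated in `Λ_tight`. For two germs
`[s, F]`, `[t, F]`, choose `κ ∈ F` in both domains. If the basic sets of `s` and `t` over `{G : κ ∈
G}` share a germ, then `s` and `t` agree at some extension of `κ`. Right cancellation brings the
agreement down to `κ` (`eq_of_agree_of_le`), hence to all of `κ Λ`, and the germs coincide. -/

noncomputable section

namespace TightGroupoid

/-! ### Isomorphisms of groupoids of germs from equivariant homeomorphisms -/

section Equivariant

variable {X : Type*} {S : InverseSubsemigroup X} {Y Z : Type*} [TopologicalSpace Y]
  [TopologicalSpace Z]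

/-- An equivariant homeomorphism between the spaces of two actions of `S`. -/
structure InvActionIso (A : InvAction S Y) (B : InvAction S Z) where
  toHomeo : Y ≃ₜ Z
  mem_dom : ∀ s y, toHomeo y ∈ B.dom s ↔ y ∈ A.dom s
  map_act : ∀ s (y : Y) (h : y ∈ A.dom s),
    toHomeo (A.act s ⟨y, h⟩) = B.act s ⟨toHomeo y, (mem_dom s y).2 h⟩

namespace InvActionIso

open InvAction

variable {A : InvAction S Y} {B : InvAction S Z}

/-- The inverse of an equivariant homeomorphism. -/
def symm (φ : InvActionIso A B) : InvActionIso B A where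
  toHomeo := φ.toHomeo.symm
  mem_dom s z := by rw [← φ.mem_dom, φ.toHomeo.apply_symm_apply]
  map_act s z h := by
    have h' : φ.toHomeo.symm z ∈ A.dom s := by
      rwa [← φ.mem_dom, φ.toHomeo.apply_symm_apply]
    rw [Homeomorph.symm_apply_eq, φ.map_act s _ h']
    exact B.act_congr rfl _ (φ.toHomeo.apply_symm_apply z).symm

/-- The map `[s, y] ↦ [s, φ y]` on germs. -/
def mapGerm (φ : InvActionIso A B) : A.Germ → B.Germ :=
  Quotient.lift (fun p => germ p.1.1 (φ.toHomeo p.1.2) ((φ.mem_dom _ _).2 p.2)) <| by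
    rintro p q ⟨h, e, he, hm, heq⟩
    exact germ_eq.2 ⟨congrArg _ h, e, he, (φ.mem_dom _ _).2 hm, heq⟩

theorem mapGerm_germ (φ : InvActionIso A B) (s : S) (y : Y) (h : y ∈ A.dom s) :
    φ.mapGerm (germ s y h) = germ s (φ.toHomeo y) ((φ.mem_dom s y).2 h) := rfl

theorem mapGerm_symm (φ : InvActionIso A B) (g : A.Germ) : φ.symm.mapGerm (φ.mapGerm g) = g := by
  obtain ⟨s, y, h, rfl⟩ := exists_germ g
  exact A.germ_congr rfl (φ.toHomeo.symm_apply_apply y)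

/-- The same `s` serves on both sides, so basic sets pull back to basic sets. Continuity of the
inverse is this lemma for `φ.symm`. -/
theorem continuous_mapGerm (φ : InvActionIso A B) : Continuous φ.mapGerm := by
  apply continuous_generateFrom_iff.2
  rintro _ ⟨s, U, hU, hUs, rfl⟩
  have : φ.mapGerm ⁻¹' B.Theta s U = A.Theta s (φ.toHomeo ⁻¹' U) := by
    ext g
    constructor
    · rintro ⟨z, hz, hz', e⟩
      refine ⟨φ.symm.toHomeo z, ?_, (φ.symm.mem_dom s z).2 hz', ?_⟩
      · change φ.toHomeo (φ.toHomeo.symm z) ∈ U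
        rwa [φ.toHomeo.apply_symm_apply]
      · rw [← φ.mapGerm_symm g, e, mapGerm_germ]
    · rintro ⟨y, hy, hy', rfl⟩
      exact ⟨_, hy, (φ.mem_dom s y).2 hy', rfl⟩
  rw [this]
  exact A.isOpen_Theta _ (hU.preimage φ.toHomeo.continuous) fun y hy =>
    (φ.mem_dom s y).1 (hUs hy)

/-- The homeomorphism of the spaces of germs induced by an equivariant homeomorphism. -/
def germHomeo (φ : InvActionIso A B) : A.Germ ≃ₜ B.Germ where
  toFun := φ.mapGerm
  invFun := φ.symm.mapGerm
  left_inv := φ.mapGerm_symm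
  right_inv := φ.symm.mapGerm_symm
  continuous_toFun := φ.continuous_mapGerm
  continuous_invFun := φ.symm.continuous_mapGerm

/-- An equivariant homeomorphism induces an isomorphism of the groupoids of germs. -/
def groupoidIso (φ : InvActionIso A B) : TopGroupoidIso A.groupoid B.groupoid where
  arrows := φ.germHomeo
  units := φ.toHomeo
  map_d g := by
    obtain ⟨s, y, h, rfl⟩ := exists_germ g
    rfl
  map_r g := by
    obtain ⟨s, y, h, rfl⟩ := exists_germ g
    exact (φ.map_act s y h).symm
  map_mul g h e := by
    obtain ⟨s, x, hs, rfl⟩ := exists_germ g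
    obtain ⟨t, y, ht, rfl⟩ := exists_germ h
    have e' : x = A.act t ⟨y, ht⟩ := e
    refine (congrArg φ.mapGerm (A.mul_germ s t x y hs ht e)).trans ?_
    exact (B.mul_germ s t _ _ ((φ.mem_dom s x).2 hs) ((φ.mem_dom t y).2 ht)
      ((congrArg _ e').trans (φ.map_act t y ht))).symm

end InvActionIso

end Equivariant

/-! ### Domains of idempotents -/

section IdemDom

variable {X : Type*} {S : InverseSubsemigroup X}

/-- The domain of an idempotent partial bijection. -/
def idemDom (e : S) : Set X := {a | a ∈ e.1 a}

theorem mem_idemDom {e : S} {a : X} : a ∈ idemDom e ↔ a ∈ e.1 a := Iff.rfl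

/-- An idempotent partial bijection fixes every point where it is defined. This and the next lemmas
turn the algebra of idempotents into set algebra of domains: products become intersections, the
order becomes inclusion, nonzero becomes nonempty. -/
theorem idem_ext {e f : S} (he : IsIdempotentElem e) (hf : IsIdempotentElem f)
    (h : idemDom e = idemDom f) : e = f := by
  apply Subtype.ext
  apply mem_ext
  intro a b
  have h' : a ∈ e.1 a ↔ a ∈ f.1 a := Set.ext_iff.1 h a
  constructor
  · intro hb
    obtain rfl := mem_idem (idem_val he) hb
    exact h'.1 hb
  · intro hb
    obtain rfl := mem_idem (idem_val hf) hb
    exact h'.2 hb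

theorem idemDom_mul {e f : S} (hf : IsIdempotentElem f) :
    idemDom (e * f) = idemDom e ∩ idemDom f := by
  ext a
  change a ∈ (e.1 * f.1) a ↔ _
  rw [mem_mul]
  constructor
  · rintro ⟨b, h1, h2⟩
    obtain rfl := mem_idem (idem_val hf) h1
    exact ⟨h2, h1⟩
  · rintro ⟨h1, h2⟩
    exact ⟨a, h2, h1⟩

theorem eq_mul_iff {e f : S} (he : IsIdempotentElem e) (hf : IsIdempotentElem f) :
    e = e * f ↔ idemDom e ⊆ idemDom f := by
  constructor
  · intro h
    rw [h, idemDom_mul hf]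
    exact inter_subset_right
  · intro h
    refine idem_ext he (idem_mul he hf) ?_
    rw [idemDom_mul hf, inter_eq_left.2 h]

theorem ne_bot_iff {e : S} (he : IsIdempotentElem e) : e.1 ≠ ⊥ ↔ (idemDom e).Nonempty := by
  constructor
  · intro h
    by_contra hn
    refine h (mem_ext fun a b => ⟨fun hb => ?_, fun hb => by cases hb⟩)
    obtain rfl := mem_idem (idem_val he) hb
    exact (hn ⟨_, hb⟩).elim
  · rintro ⟨a, ha⟩ h
    rw [mem_idemDom, h] at ha
    cases ha

/-- Conjugation pulls the domain of `f` back along `s`; membership in `s · η` is expressed through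
this conjugate. -/
theorem mem_idemDom_conj {s f : S} (hf : IsIdempotentElem f) {a : X} :
    a ∈ idemDom (star s * f * s) ↔ ∃ b, b ∈ s.1 a ∧ b ∈ idemDom f := by
  change a ∈ (star s.1 * f.1 * s.1) a ↔ _
  simp only [mem_mul, mem_star]
  constructor
  · rintro ⟨b, h1, c, h2, h3⟩
    obtain rfl := mem_idem (idem_val hf) h2
    exact ⟨_, h1, h2⟩
  · rintro ⟨b, h1, h2⟩
    exact ⟨b, h1, b, h2, h1⟩

theorem mem_idemDom_star_mul {s : S} {a : X} :
    a ∈ idemDom (star s * s) ↔ ∃ b, b ∈ s.1 a := by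
  change a ∈ (star s.1 * s.1) a ↔ _
  simp only [mem_mul, mem_star, and_self]

end IdemDom

/-! ### Ultrafilters of idempotents -/

namespace IdemFilter

variable {X : Type*} {S : InverseSubsemigroup X}

/-- The filter generated by a filter `ξ` and an idempotent meeting every element of `ξ`. -/
def adjoin (ξ : IdemFilter S) (g : S) (hg : IsIdempotentElem g)
    (h : ∀ f ∈ ξ, (idemDom f ∩ idemDom g).Nonempty) : IdemFilter S where
  carrier := {k | IsIdempotentElem k ∧ ∃ f ∈ ξ, idemDom f ∩ idemDom g ⊆ idemDom k}
  idem k hk := hk.1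
  nonempty := by
    obtain ⟨f, hf⟩ := ξ.nonempty
    exact ⟨g, hg, f, hf, inter_subset_right⟩
  up := by
    rintro e ⟨he, f, hf, hfe⟩ k hk hek
    exact ⟨hk, f, hf, hfe.trans ((eq_mul_iff he hk).1 hek)⟩
  mul_mem := by
    rintro e ⟨he, f, hf, hfe⟩ k ⟨hk, f', hf', hfk⟩
    refine ⟨idem_mul he hk, f * f', ξ.mul_mem f hf f' hf', ?_⟩
    rw [idemDom_mul hk, idemDom_mul (ξ.idem f' hf')]
    exact fun a ha => ⟨hfe ⟨ha.1.1, ha.2⟩, hfk ⟨ha.1.2, ha.2⟩⟩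
  ne_zero := by
    rintro e ⟨he, f, hf, hfe⟩
    exact (ne_bot_iff he).2 ((h f hf).mono hfe)

/-- An ultrafilter contains every idempotent which meets all of its elements. -/
theorem IsUltra.mem_of_meets {ξ : IdemFilter S} (hξ : IsUltra ξ) {g : S}
    (hg : IsIdempotentElem g) (h : ∀ f ∈ ξ, (idemDom f ∩ idemDom g).Nonempty) : g ∈ ξ := by
  refine hξ (ξ.adjoin g hg h) (fun f hf => ?_) ?_
  · exact ⟨ξ.idem f hf, f, hf, inter_subset_left⟩
  · obtain ⟨f, hf⟩ := ξ.nonempty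
    exact ⟨hg, f, hf, inter_subset_right⟩

/-- The principal filter of a nonzero idempotent. -/
def principal (e : S) (he : IsIdempotentElem e) (h : (idemDom e).Nonempty) : IdemFilter S where
  carrier := {k | IsIdempotentElem k ∧ idemDom e ⊆ idemDom k}
  idem k hk := hk.1
  nonempty := ⟨e, he, Subset.rfl⟩
  up := by
    rintro f ⟨hf, hef⟩ k hk hfk
    exact ⟨hk, hef.trans ((eq_mul_iff hf hk).1 hfk)⟩
  mul_mem := by
    rintro f ⟨hf, hef⟩ k ⟨hk, hek⟩
    refine ⟨idem_mul hf hk, ?_⟩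
    rw [idemDom_mul hk]
    exact subset_inter hef hek
  ne_zero := by
    rintro f ⟨hf, hef⟩
    exact (ne_bot_iff hf).2 (h.mono hef)

/-- Every filter is contained in an ultrafilter. -/
theorem exists_ultra_ge (η : IdemFilter S) : ∃ ξ : IdemFilter S, IsUltra ξ ∧ (η : Set S) ⊆ ξ := by
  -- Zorn's lemma on underlying sets: the union of a nonempty chain of filters is a filter, two
  -- factors of a product lying in a common member by comparability.
  obtain ⟨M, hM, hmax⟩ := zorn_subset_nonempty (range fun ξ : IdemFilter S => (ξ : Set S)) (by
    rintro c hc hchain ⟨a, ha⟩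
    have hfil : ∀ t ∈ c, ∃ ξ : IdemFilter S, (ξ : Set S) = t := hc
    refine ⟨⋃₀ c, ⟨
      { carrier := ⋃₀ c
        idem := ?_
        nonempty := ?_
        up := ?_
        mul_mem := ?_
        ne_zero := ?_ }, rfl⟩, fun t ht => subset_sUnion_of_mem ht⟩
    · rintro e ⟨t, ht, he⟩
      obtain ⟨ξ, rfl⟩ := hfil t ht
      exact ξ.idem e he
    · obtain ⟨ξ, rfl⟩ := hfil a ha
      obtain ⟨e, he⟩ := ξ.nonempty
      exact ⟨e, _, ha, he⟩
    · rintro e ⟨t, ht, he⟩ f hf hef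
      obtain ⟨ξ, rfl⟩ := hfil t ht
      exact ⟨_, ht, ξ.up e he f hf hef⟩
    · rintro e ⟨t, ht, he⟩ f ⟨t', ht', hf⟩
      rcases hchain.total ht ht' with hle | hle
      · obtain ⟨ξ, rfl⟩ := hfil t' ht'
        exact ⟨_, ht', ξ.mul_mem e (hle he) f hf⟩
      · obtain ⟨ξ, rfl⟩ := hfil t ht
        exact ⟨_, ht, ξ.mul_mem e he f (hle hf)⟩
    · rintro e ⟨t, ht, he⟩
      obtain ⟨ξ, rfl⟩ := hfil t ht
      exact ξ.ne_zero e he) η ⟨η, rfl⟩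
  obtain ⟨ξ, rfl⟩ := hmax.prop
  exact ⟨ξ, fun ξ' h => hmax.le_of_ge ⟨ξ', rfl⟩ h, hM⟩

end IdemFilter

/-! ### Filters of idempotents and hereditary directed sets -/

section SmallCategory

variable {C : Type u} [Category.{v} C]

/-- In a finitely aligned category, the intersection of two finitely generated right ideals is
finitely generated. -/
theorem FinitelyAligned.exists_finite_inter (hC : FinitelyAligned C) {A B : Set (Mor C)}
    (hA : A.Finite) (hB : B.Finite) : ∃ Γ : Set (Mor C), Γ.Finite ∧
      ∀ γ, (∃ ζ ∈ Γ, ζ ≤ γ) ↔ (∃ α ∈ A, α ≤ γ) ∧ ∃ β ∈ B, β ≤ γ := by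
  choose Γ hΓ hΓ' using hC
  have key : ∀ α β γ, (∃ ζ ∈ Γ α β, ζ ≤ γ) ↔ α ≤ γ ∧ β ≤ γ := by
    intro α β γ
    have := Set.ext_iff.1 (hΓ' α β) γ
    simpa using this.symm
  refine ⟨⋃ α ∈ A, ⋃ β ∈ B, Γ α β, hA.biUnion fun α _ => hB.biUnion fun β _ => hΓ α β, ?_⟩
  intro γ
  simp only [mem_iUnion]
  constructor
  · rintro ⟨ζ, ⟨α, hα, β, hβ, hζ⟩, hle⟩
    obtain ⟨h1, h2⟩ := (key α β γ).1 ⟨ζ, hζ, hle⟩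
    exact ⟨⟨α, hα, h1⟩, β, hβ, h2⟩
  · rintro ⟨⟨α, hα, h1⟩, β, hβ, h2⟩
    obtain ⟨ζ, hζ, hle⟩ := (key α β γ).2 ⟨h1, h2⟩
    exact ⟨ζ, ⟨α, hα, β, hβ, hζ⟩, hle⟩

namespace Paths

theorem isOpen_notMem (γ : Mor C) : IsOpen {F : Order.Ideal (Mor C) | γ ∉ F} := by
  have : {F : Order.Ideal (Mor C) | γ ∉ F} = basicOpen ∅ {γ} := by
    ext F
    simp [basicOpen]
  rw [this]
  exact isOpen_basicOpen finite_empty (finite_singleton _)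

/-- Two different sets are told apart by a single `γ`, and both containing `γ` and omitting `γ` are
open conditions. -/
instance : T2Space (Order.Ideal (Mor C)) := by
  refine ⟨fun F G hne => ?_⟩
  have h : ∃ γ, ¬ (γ ∈ F ↔ γ ∈ G) := by
    by_contra! h
    exact hne (SetLike.ext h)
  obtain ⟨γ, h⟩ := h
  by_cases hF : γ ∈ F
  · exact ⟨_, _, isOpen_mem γ, isOpen_notMem γ, hF, fun hG => h (iff_of_true hF hG),
      Set.disjoint_left.2 fun _ h1 h2 => h2 h1⟩
  · refine ⟨_, _, isOpen_notMem γ, isOpen_mem γ, hF, ?_, Set.disjoint_left.2 fun _ h1 h2 => h1 h2⟩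
    by_contra hG
    exact h (iff_of_false hF hG)

/-- If a tight set `F` contains `α` and is disjoint from the finite set `B`, then some extension of
`α` has no common extension with an element of `B`. -/
theorem IsTight.exists_not_meets (hC : FinitelyAligned C) {F : Order.Ideal (Mor C)}
    (hF : IsTight F) {α : Mor C} (hα : α ∈ F) {B : Set (Mor C)} (hB : B.Finite)
    (hBF : ∀ β ∈ B, β ∉ F) : ∃ γ, α ≤ γ ∧ ∀ β ∈ B, ¬ Meets β γ := by
  by_contra! hn
  -- If every extension of `α` met `B`, the finitely many generators of `α Λ ∩ ⋃ β Λ` would be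
  -- exhaustive in `α Λ`. Then `F` would contain a generator, and by heredity the element of `B`
  -- below it.
  obtain ⟨Γ, hΓ, hΓ'⟩ := hC.exists_finite_inter (finite_singleton α) hB
  obtain ⟨ζ, hζ, hζF⟩ := (isTight_iff hC F).1 hF α hα Γ hΓ (by
    constructor
    · intro ζ hζ
      obtain ⟨⟨_, rfl, h⟩, -⟩ := (hΓ' ζ).1 ⟨ζ, hζ, le_rfl⟩
      exact h
    · intro γ hγ
      obtain ⟨β, hβ, κ, h1, h2⟩ := hn γ hγ
      obtain ⟨ζ, hζ, hle⟩ := (hΓ' κ).2 ⟨⟨α, rfl, le_trans hγ h2⟩, β, hβ, h1⟩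
      exact ⟨ζ, hζ, κ, hle, h2⟩)
  obtain ⟨-, β, hβ, hle⟩ := (hΓ' ζ).1 ⟨ζ, hζ, le_rfl⟩
  exact hBF β hβ (F.lower hle hζF)

end Paths

variable [LeftCancellative C]

/-! ### Finite generation of domains and ranges in `S_Λ` -/

/-- The ideal `s(α) Λ` is generated by the identity at `s(α)`. With the companion for `sigma`, this
starts the induction showing that all domains are finitely generated. -/
theorem exists_mem_tau {α β : Mor C} :
    (∃ γ, γ ∈ tau α β) ↔ (⟨α.src, α.src, 𝟙 _⟩ : Mor C) ≤ β := by
  constructor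
  · rintro ⟨γ, h⟩
    obtain ⟨x, δ, rfl, rfl⟩ := mem_ofGraph.1 h
    exact ⟨x, δ, by rw [Category.comp_id]⟩
  · rintro ⟨x, δ, rfl⟩
    exact ⟨_, mem_ofGraph.2 ⟨x, δ, by rw [Category.comp_id], rfl⟩⟩

theorem exists_mem_sigma {α β : Mor C} : (∃ γ, γ ∈ sigma α β) ↔ α ≤ β := by
  constructor
  · rintro ⟨γ, h⟩
    obtain ⟨x, δ, rfl, rfl⟩ := mem_ofGraph.1 (mem_star.1 h)
    exact ⟨x, δ, rfl⟩
  · rintro ⟨x, δ, rfl⟩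
    exact ⟨⟨x, α.src, δ⟩, mem_star.2 (mem_ofGraph.2 ⟨x, δ, rfl, rfl⟩)⟩

/-- The element `τ^α` of `S_Λ`. -/
def tauS (α : Mor C) : semigroupOf C := ⟨tau α, Subsemigroup.subset_closure (Or.inr ⟨α, rfl⟩)⟩

/-- The idempotent `τ^α σ^α`, which is the identity of `α Λ`. -/
def rangeIdem (α : Mor C) : semigroupOf C := tauS α * star (tauS α)

theorem isIdempotentElem_rangeIdem (α : Mor C) : IsIdempotentElem (rangeIdem α) :=
  idem_mul_star _

theorem idemDom_rangeIdem (α : Mor C) : idemDom (rangeIdem α) = Ici α := by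
  ext β
  -- As `star` is an involution, `τ^α σ^α` is `star s * s` for `s = σ^α`, so its domain is that of
  -- `σ^α`.
  exact (mem_idemDom_star_mul (s := star (tauS α))).trans exists_mem_sigma

/-- Elements of `S_Λ` commute with right multiplication, so domains are right ideals. -/
theorem idemDom_mono {e : semigroupOf C} (he : IsIdempotentElem e) {α β : Mor C}
    (h : α ∈ idemDom e) (hle : α ≤ β) : β ∈ idemDom e := by
  obtain ⟨β', h1, -⟩ := lift_le e h hle
  obtain rfl := mem_idem (idem_val he) h1
  exact h1

/-- The domain of `s t` is the preimage under `t` of the domain of `s` intersected with the range of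
`t`. The generators of this intersection lie in the range of `t`, and `t` preserves and reflects
`≤`, so their preimages under `t` generate the domain. The range of `t` enters, so the induction
must carry ranges along with domains. -/
theorem FinitelyAligned.exists_finite_dom_mul (hC : FinitelyAligned C) (s t : semigroupOf C)
    {A B : Set (Mor C)} (hA : A.Finite) (hB : B.Finite)
    (hs : ∀ γ, (∃ γ', γ' ∈ s.1 γ) ↔ ∃ ζ ∈ A, ζ ≤ γ)
    (ht : ∀ γ, (∃ γ', γ' ∈ (star t).1 γ) ↔ ∃ ζ ∈ B, ζ ≤ γ) :
    ∃ Γ : Set (Mor C), Γ.Finite ∧ ∀ γ, (∃ γ', γ' ∈ (s * t).1 γ) ↔ ∃ ζ ∈ Γ, ζ ≤ γ := by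
  obtain ⟨Γ, hΓ, hΓ'⟩ := hC.exists_finite_inter hA hB
  refine ⟨{ζ | ∃ ε ∈ Γ, ε ∈ t.1 ζ}, Paths.finite_pull t hΓ, fun γ => ?_⟩
  constructor
  · rintro ⟨γ', h⟩
    obtain ⟨β, h1, h2⟩ := mem_mul.1 h
    obtain ⟨ε, hε, hle⟩ := (hΓ' β).2 ⟨(hs β).1 ⟨γ', h2⟩, (ht β).1 ⟨γ, mem_star.2 h1⟩⟩
    obtain ⟨-, h3⟩ := (hΓ' ε).1 ⟨ε, hε, le_rfl⟩
    obtain ⟨ζ, h4⟩ := (ht ε).2 h3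
    have h4 : ε ∈ t.1 ζ := mem_star.1 h4
    exact ⟨ζ, ⟨ε, hε, h4⟩, le_of_mem' t h4 h1 hle⟩
  · rintro ⟨ζ, ⟨ε, hε, h1⟩, hle⟩
    obtain ⟨h2, -⟩ := (hΓ' ε).1 ⟨ε, hε, le_rfl⟩
    obtain ⟨ε', h3⟩ := (hs ε).2 h2
    have h4 : ε' ∈ (s * t).1 ζ := mem_mul.2 ⟨ε, h1, h3⟩
    obtain ⟨γ', h5, -⟩ := lift_le (s * t) h4 hle
    exact ⟨γ', h5⟩

/-- In a finitely aligned category the domain and the range of every element of `S_Λ` are finitely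
generated right ideals. -/
theorem FinitelyAligned.exists_finite_dom (hC : FinitelyAligned C) (s : semigroupOf C) :
    (∃ Γ : Set (Mor C), Γ.Finite ∧ ∀ γ, (∃ γ', γ' ∈ s.1 γ) ↔ ∃ ζ ∈ Γ, ζ ≤ γ) ∧
      ∃ Γ : Set (Mor C), Γ.Finite ∧ ∀ γ, (∃ γ', γ' ∈ (star s).1 γ) ↔ ∃ ζ ∈ Γ, ζ ≤ γ := by
  have htau : ∀ α : Mor C, ∃ Γ : Set (Mor C), Γ.Finite ∧
      ∀ γ, (∃ γ', γ' ∈ tau α γ) ↔ ∃ ζ ∈ Γ, ζ ≤ γ := fun α =>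
    ⟨{⟨α.src, α.src, 𝟙 _⟩}, finite_singleton _, fun γ =>
      exists_mem_tau.trans (by simp)⟩
  have hsigma : ∀ α : Mor C, ∃ Γ : Set (Mor C), Γ.Finite ∧
      ∀ γ, (∃ γ', γ' ∈ sigma α γ) ↔ ∃ ζ ∈ Γ, ζ ≤ γ := fun α =>
    ⟨{α}, finite_singleton _, fun γ => exists_mem_sigma.trans (by simp)⟩
  obtain ⟨s, hs⟩ := s
  have hs' : s ∈ Subsemigroup.closure (range (sigma (C := C)) ∪ range (tau (C := C))) := hs
  induction hs' using Subsemigroup.closure_induction with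
  | mem s h =>
    rcases h with ⟨α, rfl⟩ | ⟨α, rfl⟩
    · exact ⟨hsigma α, htau α⟩
    · exact ⟨htau α, hsigma α⟩
  | mul s t h h' ihs iht =>
    obtain ⟨⟨A, hA, hA'⟩, A', hA₂, hA₂'⟩ := ihs h
    obtain ⟨⟨B, hB, hB'⟩, B', hB₂, hB₂'⟩ := iht h'
    -- The range of `s t` is the domain of `t⋆ s⋆`; the roles of domain and range swap, so the same
    -- two generating sets `A` and `B'` serve both halves.
    exact ⟨hC.exists_finite_dom_mul ⟨s, h⟩ ⟨t, h'⟩ hA hB₂ hA' hB₂',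
      hC.exists_finite_dom_mul (star ⟨t, h'⟩) (star ⟨s, h⟩) hB₂ hA hB₂' hA'⟩

theorem FinitelyAligned.exists_finite_idemDom (hC : FinitelyAligned C) {e : semigroupOf C}
    (he : IsIdempotentElem e) :
    ∃ Γ : Set (Mor C), Γ.Finite ∧ ∀ γ, γ ∈ idemDom e ↔ ∃ ζ ∈ Γ, ζ ≤ γ := by
  obtain ⟨Γ, hΓ, h⟩ := (hC.exists_finite_dom e).1
  refine ⟨Γ, hΓ, fun γ => Iff.trans ⟨fun h' => ⟨γ, h'⟩, ?_⟩ (h γ)⟩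
  rintro ⟨γ', h'⟩
  obtain rfl := mem_idem (idem_val he) h'
  exact h'

/-! ### From tight filters to tight hereditary directed sets -/

namespace IdemFilter

theorem mem_of_idemDom_subset {η : IdemFilter (semigroupOf C)} {e f : semigroupOf C} (he : e ∈ η)
    (hf : IsIdempotentElem f) (h : idemDom e ⊆ idemDom f) : f ∈ η :=
  η.up e he f hf ((eq_mul_iff (η.idem e he) hf).2 h)

theorem rangeIdem_mem_of_le {η : IdemFilter (semigroupOf C)} {α β : Mor C} (h : rangeIdem β ∈ η)
    (hle : α ≤ β) : rangeIdem α ∈ η := by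
  refine mem_of_idemDom_subset h (isIdempotentElem_rangeIdem α) ?_
  rw [idemDom_rangeIdem, idemDom_rangeIdem]
  exact Ici_subset_Ici.2 hle

/-- By maximality, an ultrafilter omitting `rangeIdem ζ` has a member whose domain is disjoint from
`ζ Λ`. The product `f` of such members over `Z` avoids every `ζ Λ`, yet `f * e` is nonzero: a point
of its domain has a common extension with some `ζ`, and that extension stays in the domain of `f`.
-/
theorem IsUltra.exists_rangeIdem_mem {ξ : IdemFilter (semigroupOf C)} (hξ : IsUltra ξ)
    {e : semigroupOf C} (he : e ∈ ξ) {Z : Set (Mor C)} (hZ : Z.Finite)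
    (h : ∀ γ ∈ idemDom e, ∃ ζ ∈ Z, Meets ζ γ) : ∃ ζ ∈ Z, rangeIdem ζ ∈ ξ := by
  by_contra! hn
  have key : ∃ f ∈ ξ, ∀ ζ ∈ Z, ∀ γ ∈ idemDom f, ¬ ζ ≤ γ := by
    -- Covering does not pass to subsets of `Z`, so it is dropped before the induction; only the
    -- omission of each `rangeIdem ζ` is used to build `f`.
    clear h
    induction Z, hZ using Set.Finite.induction_on with
    | empty => exact ⟨e, he, by simp⟩
    | @insert ζ Z _ _ ih =>
      obtain ⟨f, hf, h1⟩ := ih fun ζ' h' => hn ζ' (Or.inr h')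
      have h2 : ∃ g ∈ ξ, ¬ (idemDom g ∩ idemDom (rangeIdem ζ)).Nonempty := by
        by_contra! h2
        exact hn ζ (Or.inl rfl) (hξ.mem_of_meets (isIdempotentElem_rangeIdem ζ) h2)
      obtain ⟨g, hg, h2⟩ := h2
      rw [idemDom_rangeIdem] at h2
      refine ⟨f * g, ξ.mul_mem f hf g hg, ?_⟩
      rw [idemDom_mul (ξ.idem g hg)]
      rintro ζ' (rfl | h') γ hγ hle
      · exact h2 ⟨γ, hγ.2, hle⟩
      · exact h1 ζ' h' γ hγ.1 hle
  obtain ⟨f, hf, hfZ⟩ := key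
  have hfe := ξ.mul_mem f hf e he
  obtain ⟨γ, hγ⟩ := (ne_bot_iff (ξ.idem _ hfe)).1 (ξ.ne_zero _ hfe)
  rw [idemDom_mul (ξ.idem e he)] at hγ
  obtain ⟨ζ, hζ, κ, h1, h2⟩ := h γ hγ.2
  exact hfZ ζ hζ κ (idemDom_mono (ξ.idem f hf) hγ.1 h2) h1

/-- If a finite set `Z` covers the idempotent `e` of a tight filter `η`, then `η` contains the
identity of `ζ Λ` for some `ζ ∈ Z`. -/
theorem exists_rangeIdem_mem {η : IdemFilter (semigroupOf C)} (hη : η ∈ tight (semigroupOf C))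
    {e : semigroupOf C} (he : e ∈ η) {Z : Set (Mor C)} (hZ : Z.Finite)
    (h : ∀ γ ∈ idemDom e, ∃ ζ ∈ Z, Meets ζ γ) : ∃ ζ ∈ Z, rangeIdem ζ ∈ η := by
  by_contra! hn
  -- Containing `e` and omitting the finitely many `rangeIdem ζ` is a basic open condition, so some
  -- ultrafilter would satisfy it as well.
  obtain ⟨ξ, ⟨h1, h2⟩, hξ⟩ := mem_closure_iff.1 hη
    (basicOpen (semigroupOf C) {e} (rangeIdem '' Z))
    (isOpen_basicOpen (finite_singleton _) (hZ.image _)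
      (by rintro _ rfl; exact η.idem _ he)
      (by rintro _ ⟨ζ, -, rfl⟩; exact isIdempotentElem_rangeIdem ζ))
    ⟨by rintro _ rfl; exact he, Set.disjoint_left.2 (by rintro _ ⟨ζ, hζ, rfl⟩; exact hn ζ hζ)⟩
  obtain ⟨ζ, hζ, h3⟩ := hξ.exists_rangeIdem_mem (h1 rfl) hZ h
  exact Set.disjoint_left.1 h2 ⟨ζ, hζ, rfl⟩ h3

/-- A tight filter is determined by the idempotents `τ^γ σ^γ` which it contains. -/
theorem mem_iff_exists_rangeIdem (hC : FinitelyAligned C) {η : IdemFilter (semigroupOf C)}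
    (hη : η ∈ tight (semigroupOf C)) {e : semigroupOf C} (he : IsIdempotentElem e) :
    e ∈ η ↔ ∃ γ, rangeIdem γ ∈ η ∧ γ ∈ idemDom e := by
  constructor
  · intro h
    obtain ⟨Γ, hΓ, hΓ'⟩ := hC.exists_finite_idemDom he
    -- The finite generators of the domain of `e` cover it, each element meeting the generator below
    -- it.
    obtain ⟨ζ, hζ, h1⟩ := exists_rangeIdem_mem hη h hΓ fun γ hγ => by
      obtain ⟨ζ, hζ, hle⟩ := (hΓ' γ).1 hγ
      exact ⟨ζ, hζ, γ, hle, mem_Ici.2 le_rfl⟩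
    exact ⟨ζ, h1, (hΓ' ζ).2 ⟨ζ, hζ, le_rfl⟩⟩
  · rintro ⟨γ, h1, h2⟩
    refine mem_of_idemDom_subset h1 he ?_
    rw [idemDom_rangeIdem]
    exact fun δ hδ => idemDom_mono he h2 hδ

/-- The hereditary directed set `{γ : τ^γ σ^γ ∈ η}` of a tight filter `η`. -/
def toIdeal (hC : FinitelyAligned C) (η : IdemFilter (semigroupOf C))
    (hη : η ∈ tight (semigroupOf C)) : Order.Ideal (Mor C) where
  carrier := {γ | rangeIdem γ ∈ η}
  lower' _ _ hle h := rangeIdem_mem_of_le h hle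
  nonempty' := by
    obtain ⟨e, he⟩ := η.nonempty
    obtain ⟨γ, hγ, -⟩ := (mem_iff_exists_rangeIdem hC hη (η.idem e he)).1 he
    exact ⟨γ, hγ⟩
  directed' := by
    intro α hα β hβ
    -- The product of the two range idempotents has domain `α Λ ∩ β Λ`, so the element found there
    -- is a common upper bound.
    obtain ⟨γ, h1, h2⟩ := (mem_iff_exists_rangeIdem hC hη
      (idem_mul (isIdempotentElem_rangeIdem α) (isIdempotentElem_rangeIdem β))).1
      (η.mul_mem _ hα _ hβ)
    rw [idemDom_mul (isIdempotentElem_rangeIdem β), idemDom_rangeIdem, idemDom_rangeIdem] at h2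
    exact ⟨γ, h1, h2.1, h2.2⟩

theorem mem_toIdeal {hC : FinitelyAligned C} {η : IdemFilter (semigroupOf C)}
    {hη : η ∈ tight (semigroupOf C)} {γ : Mor C} : γ ∈ η.toIdeal hC hη ↔ rangeIdem γ ∈ η := Iff.rfl

/-- By `isTight_iff` only exhaustive subsets of `α Λ` need testing, and exhaustiveness is exactly
the covering hypothesis of `exists_rangeIdem_mem` for `rangeIdem α`. -/
theorem toIdeal_tight (hC : FinitelyAligned C) (η : IdemFilter (semigroupOf C))
    (hη : η ∈ tight (semigroupOf C)) : η.toIdeal hC hη ∈ Paths.tight C := by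
  refine (Paths.isTight_iff hC _).2 fun α hα Z hZ hex => ?_
  refine exists_rangeIdem_mem hη (mem_toIdeal.1 hα) hZ ?_
  rw [idemDom_rangeIdem]
  exact hex.2

end IdemFilter

/-! ### From tight hereditary directed sets to tight filters -/

namespace Paths

/-- The filter of the idempotents whose domain meets `F`. -/
def toFilter (F : Order.Ideal (Mor C)) : IdemFilter (semigroupOf C) where
  carrier := {e | IsIdempotentElem e ∧ ∃ γ ∈ F, γ ∈ idemDom e}
  idem e he := he.1
  nonempty := by
    obtain ⟨γ, hγ⟩ := F.nonempty
    refine ⟨rangeIdem γ, isIdempotentElem_rangeIdem γ, γ, hγ, ?_⟩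
    rw [idemDom_rangeIdem]
    exact mem_Ici.2 le_rfl
  up := by
    rintro e ⟨he, γ, hγ, h⟩ f hf hef
    exact ⟨hf, γ, hγ, (eq_mul_iff he hf).1 hef h⟩
  mul_mem := by
    rintro e ⟨he, γ, hγ, h⟩ f ⟨hf, δ, hδ, h'⟩
    obtain ⟨ε, hε, l1, l2⟩ := F.directed γ hγ δ hδ
    refine ⟨idem_mul he hf, ε, hε, ?_⟩
    rw [idemDom_mul hf]
    exact ⟨idemDom_mono he h l1, idemDom_mono hf h' l2⟩
  ne_zero := by
    rintro e ⟨he, γ, hγ, h⟩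
    exact (ne_bot_iff he).2 ⟨γ, h⟩

theorem mem_toFilter {F : Order.Ideal (Mor C)} {e : semigroupOf C} :
    e ∈ toFilter F ↔ IsIdempotentElem e ∧ ∃ γ ∈ F, γ ∈ idemDom e := Iff.rfl

/-- Heredity alone gives this; it is one of the two inverse laws of the correspondence. -/
theorem rangeIdem_mem_toFilter {F : Order.Ideal (Mor C)} {γ : Mor C} :
    rangeIdem γ ∈ toFilter F ↔ γ ∈ F := by
  rw [mem_toFilter, idemDom_rangeIdem]
  constructor
  · rintro ⟨-, δ, hδ, hle⟩
    exact F.lower hle hδ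
  · intro h
    exact ⟨isIdempotentElem_rangeIdem γ, γ, h, mem_Ici.2 le_rfl⟩

/-- Directedness bounds finitely many witnesses by one element of `F`, which stays in each domain
because domains are right ideals. -/
theorem exists_mem_forall_idemDom (F : Order.Ideal (Mor C)) {P : Set (semigroupOf C)}
    (hP : P.Finite) (h : ∀ e ∈ P, e ∈ toFilter F) : ∃ α ∈ F, ∀ e ∈ P, α ∈ idemDom e := by
  induction P, hP using Set.Finite.induction_on with
  | empty =>
    obtain ⟨α, hα⟩ := F.nonempty
    exact ⟨α, hα, by simp⟩
  | @insert e P _ _ ih =>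
    obtain ⟨α, hα, h1⟩ := ih fun f hf => h f (Or.inr hf)
    obtain ⟨he, β, hβ, h2⟩ := h e (Or.inl rfl)
    obtain ⟨γ, hγ, l1, l2⟩ := F.directed α hα β hβ
    refine ⟨γ, hγ, ?_⟩
    rintro f (rfl | hf)
    · exact idemDom_mono he h2 l2
    · exact idemDom_mono (h f (Or.inr hf)).1 (h1 f hf) l1

/-- Each basic neighbourhood of the filter must contain an ultrafilter. Some `α ∈ F` lies in all
domains required by `P`, and tightness extends it to a `γ` meeting no generator of a domain
forbidden by `Q`; any ultrafilter containing `rangeIdem γ` then works. -/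
theorem toFilter_tight (hC : FinitelyAligned C) {F : Order.Ideal (Mor C)} (hF : F ∈ tight C) :
    toFilter F ∈ IdemFilter.tight (semigroupOf C) := by
  have hbasis : TopologicalSpace.IsTopologicalBasis {W | ∃ P Q : Set (semigroupOf C),
      P.Finite ∧ Q.Finite ∧ (∀ e ∈ P, IsIdempotentElem e) ∧ (∀ e ∈ Q, IsIdempotentElem e) ∧
        W = IdemFilter.basicOpen (semigroupOf C) P Q} := by
    refine ⟨?_, ?_, rfl⟩
    · rintro _ ⟨P, Q, hP, hQ, hP', hQ', rfl⟩ _ ⟨P₂, Q₂, hP₂, hQ₂, hP₂', hQ₂', rfl⟩ η ⟨h1, h2⟩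
      refine ⟨_, ⟨P ∪ P₂, Q ∪ Q₂, hP.union hP₂, hQ.union hQ₂, ?_, ?_, rfl⟩, ?_, ?_⟩
      · rintro e (he | he)
        exacts [hP' e he, hP₂' e he]
      · rintro e (he | he)
        exacts [hQ' e he, hQ₂' e he]
      · exact ⟨union_subset h1.1 h2.1, disjoint_union_left.2 ⟨h1.2, h2.2⟩⟩
      · rintro ξ ⟨h3, h4⟩
        rw [union_subset_iff] at h3
        rw [disjoint_union_left] at h4
        exact ⟨⟨h3.1, h4.1⟩, h3.2, h4.2⟩
    · refine eq_univ_of_forall fun η => ⟨_, ⟨∅, ∅, finite_empty, finite_empty, by simp, by simp,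
        rfl⟩, by simp [IdemFilter.basicOpen]⟩
  refine hbasis.mem_closure_iff.2 ?_
  rintro _ ⟨P, Q, hP, hQ, hP', hQ', rfl⟩ ⟨hPF, hQF⟩
  obtain ⟨α, hα, hαP⟩ := exists_mem_forall_idemDom F hP hPF
  -- The empty set is a default value at non-idempotents, making the choice of generators a total
  -- function.
  have hgen : ∀ e : semigroupOf C, ∃ Γ : Set (Mor C), Γ.Finite ∧
      (IsIdempotentElem e → ∀ γ, γ ∈ idemDom e ↔ ∃ ζ ∈ Γ, ζ ≤ γ) := by
    intro e
    by_cases he : IsIdempotentElem e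
    · obtain ⟨Γ, h1, h2⟩ := hC.exists_finite_idemDom he
      exact ⟨Γ, h1, fun _ => h2⟩
    · exact ⟨∅, finite_empty, fun h => (he h).elim⟩
  choose Γ hΓ hΓ' using hgen
  obtain ⟨γ, hαγ, hγ⟩ := IsTight.exists_not_meets hC hF hα (hQ.biUnion fun e _ => hΓ e) (by
    intro β hβ hβF
    obtain ⟨q, hq, hβ⟩ := mem_iUnion₂.1 hβ
    exact Set.disjoint_left.1 hQF hq
      ⟨hQ' q hq, β, hβF, (hΓ' q (hQ' q hq) β).2 ⟨β, hβ, le_rfl⟩⟩)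
  obtain ⟨ξ, hξ, hξγ⟩ := IdemFilter.exists_ultra_ge (IdemFilter.principal (rangeIdem γ)
    (isIdempotentElem_rangeIdem γ) (by rw [idemDom_rangeIdem]; exact nonempty_Ici))
  have hγξ : rangeIdem γ ∈ ξ := hξγ ⟨isIdempotentElem_rangeIdem γ, Subset.rfl⟩
  refine ⟨ξ, ⟨?_, Set.disjoint_left.2 ?_⟩, hξ⟩
  · intro e he
    refine IdemFilter.mem_of_idemDom_subset hγξ (hP' e he) ?_
    rw [idemDom_rangeIdem]
    exact fun δ hδ => idemDom_mono (hP' e he) (hαP e he) (hαγ.trans hδ)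
  · intro q hq hqξ
    -- Were `q` in `ξ`, its product with `rangeIdem γ` would be nonzero, and a point of its domain
    -- would extend both `γ` and a generator of `q`.
    have h1 := ξ.mul_mem _ hqξ _ hγξ
    obtain ⟨κ, hκ⟩ := (ne_bot_iff (ξ.idem _ h1)).1 (ξ.ne_zero _ h1)
    rw [idemDom_mul (isIdempotentElem_rangeIdem γ), idemDom_rangeIdem] at hκ
    obtain ⟨ζ, hζ, hle⟩ := (hΓ' q (hQ' q hq) κ).1 hκ.1
    exact hγ ζ (mem_iUnion₂.2 ⟨q, hq, hζ⟩) ⟨κ, hle, hκ.2⟩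

theorem isOpen_mem_toFilter {e : semigroupOf C} (he : IsIdempotentElem e) :
    IsOpen {F : Order.Ideal (Mor C) | e ∈ toFilter F} := by
  have : {F : Order.Ideal (Mor C) | e ∈ toFilter F} = ⋃ γ ∈ idemDom e, {F | γ ∈ F} := by
    ext F
    simp [mem_toFilter, he, and_comm]
  rw [this]
  exact isOpen_biUnion fun γ _ => isOpen_mem γ

/-- Omitting `e` means omitting every element of its domain, a possibly infinite intersection of
open conditions. Finite alignment reduces it to the finitely many generators. -/
theorem isOpen_notMem_toFilter (hC : FinitelyAligned C) {e : semigroupOf C}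
    (he : IsIdempotentElem e) : IsOpen {F : Order.Ideal (Mor C) | e ∉ toFilter F} := by
  obtain ⟨Γ, hΓ, hΓ'⟩ := hC.exists_finite_idemDom he
  have : {F : Order.Ideal (Mor C) | e ∉ toFilter F} = ⋂ ζ ∈ Γ, {F | ζ ∉ F} := by
    ext F
    simp only [mem_iInter]
    constructor
    · intro h ζ hζ hF
      exact h ⟨he, ζ, hF, (hΓ' ζ).2 ⟨ζ, hζ, le_rfl⟩⟩
    · rintro h ⟨-, γ, hγ, h1⟩
      obtain ⟨ζ, hζ, hle⟩ := (hΓ' γ).1 h1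
      exact h ζ hζ (F.lower hle hγ)
  rw [this]
  exact hΓ.isOpen_biInter fun ζ _ => isOpen_notMem ζ

theorem continuous_toFilter (hC : FinitelyAligned C) :
    Continuous (toFilter : Order.Ideal (Mor C) → IdemFilter (semigroupOf C)) := by
  apply continuous_generateFrom_iff.2
  rintro _ ⟨P, Q, hP, hQ, hP', hQ', rfl⟩
  have : toFilter ⁻¹' IdemFilter.basicOpen (semigroupOf C) P Q =
      (⋂ e ∈ P, {F : Order.Ideal (Mor C) | e ∈ toFilter F}) ∩
        ⋂ e ∈ Q, {F : Order.Ideal (Mor C) | e ∉ toFilter F} := by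
    ext F
    simp only [IdemFilter.basicOpen, mem_preimage, mem_inter_iff, mem_iInter, Set.disjoint_left,
      subset_def]
    rfl
  rw [this]
  exact (hP.isOpen_biInter fun e he => isOpen_mem_toFilter (hP' e he)).inter
    (hQ.isOpen_biInter fun e he => isOpen_notMem_toFilter hC (hQ' e he))

end Paths

/-! ### The equivariant homeomorphism -/

theorem IdemFilter.continuous_toIdeal (hC : FinitelyAligned C) :
    Continuous fun η : IdemFilter.tight (semigroupOf C) => η.1.toIdeal hC η.2 := by
  apply continuous_generateFrom_iff.2
  rintro _ ⟨P, Q, hP, hQ, rfl⟩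
  have : (fun η : IdemFilter.tight (semigroupOf C) => η.1.toIdeal hC η.2) ⁻¹'
      Paths.basicOpen P Q = Subtype.val ⁻¹' IdemFilter.basicOpen (semigroupOf C)
        (rangeIdem '' P) (rangeIdem '' Q) := by
    ext η
    simp only [Paths.basicOpen, IdemFilter.basicOpen, mem_preimage, Set.mem_ofPred_eq, subset_def,
      Set.disjoint_left, forall_mem_image]
    rfl
  rw [this]
  refine IsOpen.preimage continuous_subtype_val
    (IdemFilter.isOpen_basicOpen (hP.image _) (hQ.image _) ?_ ?_) <;>
  · rintro _ ⟨ζ, -, rfl⟩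
    exact isIdempotentElem_rangeIdem ζ

theorem IdemFilter.toFilter_toIdeal (hC : FinitelyAligned C) (η : IdemFilter (semigroupOf C))
    (hη : η ∈ IdemFilter.tight (semigroupOf C)) : Paths.toFilter (η.toIdeal hC hη) = η := by
  apply SetLike.ext
  intro e
  rw [Paths.mem_toFilter]
  constructor
  · rintro ⟨he, h⟩
    exact (mem_iff_exists_rangeIdem hC hη he).2 h
  · intro h
    exact ⟨η.idem e h, (mem_iff_exists_rangeIdem hC hη (η.idem e h)).1 h⟩

/-- The homeomorphism between the tight filters of idempotents of `S_Λ` and `Λ_tight`. -/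
def tightHomeo (hC : FinitelyAligned C) :
    IdemFilter.tight (semigroupOf C) ≃ₜ Paths.tight C where
  toFun η := ⟨η.1.toIdeal hC η.2, η.1.toIdeal_tight hC η.2⟩
  invFun F := ⟨Paths.toFilter F.1, Paths.toFilter_tight hC F.2⟩
  left_inv η := Subtype.ext (η.1.toFilter_toIdeal hC η.2)
  right_inv _ := Subtype.ext (SetLike.ext fun _ => Paths.rangeIdem_mem_toFilter)
  continuous_toFun := (IdemFilter.continuous_toIdeal hC).subtype_mk _
  continuous_invFun := ((Paths.continuous_toFilter hC).comp continuous_subtype_val).subtype_mk _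

/-- The homeomorphism between the tight filters and `Λ_tight` is equivariant. -/
def tightActionIso (hC : FinitelyAligned C) :
    InvActionIso (tightAction (semigroupOf C)) (pathAction hC) where
  toHomeo := tightHomeo hC
  mem_dom s η := by
    change (∃ γ, rangeIdem γ ∈ η.1 ∧ ∃ γ', γ' ∈ s.1 γ) ↔ star s * s ∈ η.1
    rw [IdemFilter.mem_iff_exists_rangeIdem hC η.2 (idem_star_mul s)]
    simp only [mem_idemDom_star_mul]
  map_act s η h := by
    apply Subtype.ext
    apply SetLike.ext
    intro δ
    change rangeIdem δ ∈ IdemFilter.act s η.1 h ↔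
      ∃ γ, rangeIdem γ ∈ η.1 ∧ ∃ γ', γ' ∈ s.1 γ ∧ δ ≤ γ'
    refine IdemFilter.mem_act.trans ?_
    -- Both actions reduce to the same condition: `rangeIdem δ ∈ s · η` iff `η` contains the
    -- conjugate of `rangeIdem δ` by `s`, whose domain consists of the `γ` with `δ ≤ s(γ)`.
    rw [and_iff_right (isIdempotentElem_rangeIdem δ),
      IdemFilter.mem_iff_exists_rangeIdem hC η.2 (idem_conj s (isIdempotentElem_rangeIdem δ))]
    simp only [mem_idemDom_conj (isIdempotentElem_rangeIdem δ), idemDom_rangeIdem, mem_Ici]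

/-! ### The Hausdorff property -/

/-- In a right cancellative category, two elements of `S_Λ` which agree at an extension of `γ` agree
at `γ`. -/
theorem eq_of_agree_of_le [RightCancellative C] {s t : semigroupOf C} {γ γ₁ γ₂ δ δ' : Mor C}
    (hs : γ₁ ∈ s.1 γ) (ht : γ₂ ∈ t.1 γ) (hle : γ ≤ δ) (hs' : δ' ∈ s.1 δ) (ht' : δ' ∈ t.1 δ) :
    γ₁ = γ₂ := by
  obtain ⟨x, y, y₁, f, f₁, rfl, rfl, h1⟩ := equivariant s _ _ hs
  obtain ⟨x', y', y₂, f', f₂, h, rfl, h2⟩ := equivariant t _ _ ht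
  cases h
  obtain ⟨z, ε, rfl⟩ := hle
  have e1 := Option.mem_unique (h1 z ε) hs'
  have e2 := Option.mem_unique (h2 z ε) ht'
  have e := e1.trans e2.symm
  injection e with _ h3 h4
  subst h3
  -- With `δ = γ ε`, equivariance gives `γ₁ ε = δ' = γ₂ ε`, and `ε` cancels on the right.
  have := RightCancellative.epi ε
  rw [cancel_epi ε |>.1 (eq_of_heq h4)]

-- Germs with different sources are separated by `d`. With a common source, the basic sets of `s`
-- and `t` over the same neighbourhood are shown disjoint: a shared germ would force the two given
-- germs to be equal.
open InvAction in
theorem t2Space_pathAction_germ [RightCancellative C] (hC : FinitelyAligned C) :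
    T2Space (pathAction hC).Germ := by
  refine ⟨fun g h hne => ?_⟩
  by_cases hd : (pathAction hC).d g = (pathAction hC).d h
  · obtain ⟨s, F, hs, rfl⟩ := exists_germ g
    obtain ⟨t, G, ht, rfl⟩ := exists_germ h
    obtain rfl : F = G := hd
    obtain ⟨γ, hγ, h1⟩ : F.1 ∈ Paths.dom s := id hs
    obtain ⟨δ, hδ, h2⟩ : F.1 ∈ Paths.dom t := id ht
    obtain ⟨κ, hκ, l1, l2⟩ := F.1.directed γ hγ δ hδ
    obtain ⟨γ', h1⟩ := h1
    obtain ⟨δ', h2⟩ := h2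
    obtain ⟨κ₁, hκ₁, -⟩ := lift_le s h1 l1
    obtain ⟨κ₂, hκ₂, -⟩ := lift_le t h2 l2
    -- As `κ` lies in the domains of both `s` and `t`, every tight set containing `κ` lies in the
    -- domains of both actions.
    let U : Set (Paths.tight C) := {F | κ ∈ F.1}
    have hU : IsOpen U := (Paths.isOpen_mem κ).preimage continuous_subtype_val
    refine ⟨_, _, (pathAction hC).isOpen_Theta s hU fun _ h => ⟨κ, h, κ₁, hκ₁⟩,
      (pathAction hC).isOpen_Theta t hU fun _ h => ⟨κ, h, κ₂, hκ₂⟩,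
      ⟨F, hκ, hs, rfl⟩, ⟨F, hκ, ht, rfl⟩, Set.disjoint_left.2 ?_⟩
    rintro _ ⟨G, hG, hGs, rfl⟩ ⟨G', hG', hGt, e⟩
    obtain ⟨rfl, e, he, ⟨ε, hε, ε', h3⟩, hst⟩ := germ_eq.1 e
    obtain rfl := mem_idem (idem_val he) h3
    -- Directedness of `G` gives an extension `ν` of `κ` in the domain of `e`; there `s e = t e`
    -- makes `s` and `t` agree.
    obtain ⟨ν, hν, l3, l4⟩ := G.1.directed ε' hε κ hG
    have hνe : ν ∈ e.1 ν := idemDom_mono he h3 l3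
    obtain ⟨ν₁, hν₁, -⟩ := lift_le s hκ₁ l4
    have h4 : ν₁ ∈ (s * e).1 ν := mem_mul.2 ⟨ν, hνe, hν₁⟩
    rw [hst] at h4
    obtain ⟨ν', h5, h6⟩ := mem_mul.1 h4
    obtain rfl := mem_idem (idem_val he) h5
    obtain rfl := eq_of_agree_of_le hκ₁ hκ₂ l4 hν₁ h6
    -- Agreement at `κ` spreads to `κ Λ` by equivariance, so `rangeIdem κ` witnesses equality of the
    -- original germs at `F`.
    refine hne (germ_eq.2 ⟨rfl, rangeIdem κ, isIdempotentElem_rangeIdem κ, ?_, ?_⟩)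
    · refine ⟨κ, hκ, κ, ?_⟩
      rw [← mem_idemDom, idemDom_rangeIdem]
      exact mem_Ici.2 le_rfl
    · apply Subtype.ext
      apply mem_ext
      intro a b
      change b ∈ (s.1 * (rangeIdem κ).1) a ↔ b ∈ (t.1 * (rangeIdem κ).1) a
      rw [mem_mul, mem_mul]
      refine exists_congr fun c => and_congr_right fun hc => ?_
      obtain rfl := mem_idem (idem_val (isIdempotentElem_rangeIdem κ)) hc
      rw [← mem_idemDom, idemDom_rangeIdem] at hc
      obtain ⟨x, y, y₁, f, f₁, rfl, rfl, h7⟩ := equivariant s _ _ hκ₁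
      obtain ⟨x', y', y₂, f', f₂, h, h', h8⟩ := equivariant t _ _ hκ₂
      cases h
      cases h'
      obtain ⟨z, ε, rfl⟩ := hc
      exact ⟨fun hb => Option.mem_unique (h7 z ε) hb ▸ h8 z ε,
        fun hb => Option.mem_unique (h8 z ε) hb ▸ h7 z ε⟩
  · obtain ⟨U, V, hU, hV, h1, h2, h3⟩ := t2_separation hd
    exact ⟨_, _, hU.preimage (pathAction hC).continuous_d, hV.preimage (pathAction hC).continuous_d,
      h1, h2, h3.preimage _⟩

end SmallCategory

end TightGroupoid

end

theorem mainTheorem11 {C : Type u} [Category.{v} C] [Countable (TightGroupoid.Mor C)]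
    [TightGroupoid.LeftCancellative C] [TightGroupoid.RightCancellative C]
    (hC : TightGroupoid.FinitelyAligned C) :
    Nonempty (TightGroupoid.TopGroupoidIso
      (TightGroupoid.tightGroupoid (TightGroupoid.semigroupOf C))
      (TightGroupoid.pathGroupoid hC)) ∧
    T2Space (TightGroupoid.tightAction (TightGroupoid.semigroupOf C)).Germ ∧
    T2Space (TightGroupoid.pathAction hC).Germ := by
  -- The Hausdorff property is proved on the path side and carried to the tight groupoid along the
  -- homeomorphism of germ spaces.
  have h := TightGroupoid.t2Space_pathAction_germ hC
  exact ⟨⟨(TightGroupoid.tightActionIso hC).groupoidIso⟩,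
    (TightGroupoid.tightActionIso hC).germHomeo.symm.t2Space, h⟩
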